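/- **Setting.** Let $F(x)=h(x)+\frac1n\sum_{i=1}^n f_i(x)$ on $\mathbb R^d$, $n\ge 1$, where every $f_i$ is convex and differentiable with $L$-Lipschitz gradient ($L>0$), $h:\mathbb R^d\to\mathbb R$ is convex, and $x^*$ is a minimiser of $F$. Write $f=\frac1n\sum_i f_i$. One call of the incremental first-order oracle (IFO) takes $(i,x)$ and returns $(f_i(x),\nabla f_i(x))$. **Algorithm (AASVRG).** Parameters: a step size $\gamma>0$, weights $\theta_1^s$, $\theta_2=\frac12$, $a^s=1-\theta_2-\theta_1^s$. Start with $x_0^0=z_0^0=\tilde x^0=0$. Epoch $s=0,1,\dots,S$ computes $\nabla f(\tilde x^s)$ and then performs, for $k=0,\dots,n-1$, $$w=x^s_{j}+\tfrac{a^s(1-(a^s)^{k-j+1})}{1-a^s}\,(x^s_{j}-x^s_{j-1}),\qquad v=\nabla f_{i}(w)-\nabla f_{i}(\tilde x^s)+\nabla f(\tilde x^s),$$ $$\delta=\operatorname*{argmin}_{\delta}\; h(z^s_k+\delta)+\langle v,\delta\rangle+\tfrac{\theta_1^s}{2\gamma}\|\delta\|^2,\qquad z^s_{k+1}=z^s_k+\delta,\qquad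 x^s_{k+1}=\theta_1^s z^s_{k+1}+\theta_2\tilde x^s+a^s x^s_k .$$ Here $i=i^s_k$ is uniform on $\{1,\dots,n\}$ and independent of the past, and $j=j(k)$ is any read index, possibly depending on the past, with $\max(0,k-\tau)\le j(k)\le k$, where $\tau\in\mathbb N$ bounds the delay. For $j=0$ the symbol $a^s(x^s_0-x^s_{-1})$ stands for $\theta_1^s z_0^s+\theta_2\tilde x^s+a^s x_0^s-x^s_0$. At the end of the epoch $x_0^{s+1}=x_n^s$, $z_0^{s+1}=z_n^s$, and $\tilde x^{s+1}$ is an average of the iterates of the epoch, specified below. **Claim.** For every $c>0$ there is a constant $C$, depending only on $c$, such that the following holds. 1. (Non-strongly convex.) Let $\theta_1^s=\frac{2}{s+4}$, $\tilde x^{s+1}=\frac1n\sum_{k=1}^{n}x^s_k$, and $c\le 5\gamma L+10\gamma L\tau^2\le 1$. If $\|x^*\|^2\le R$, $F(0)-F(x^*)\le LR$ and $\epsilon>0$, then for some number $S$, which depends on the problem, the parameters and $\epsilon$ but not on the samples or the delays, the algorithm reaches $\mathbb E\,F(\tilde x^{S+1})-F(x^*)\le\epsilon$ with at most $$C\left(n+(n+\tau\sqrt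 n)\sqrt{LR/\epsilon}\right)$$ IFO calls. That is, for bounded $R$ it needs $O\big(n+(n+\tau\sqrt n)\sqrt{L/\epsilon}\big)$ calls. 2. (Strongly convex.) Let $h$ be $\mu$-strongly convex with $0<\mu\le\frac{L\tau^2}{4n}$, $\theta_1^s=\theta_1=\frac1\tau\sqrt{\frac{n\mu}{L}}$, $\theta_3=1+\frac{\mu\gamma}{\theta_1}$, $\tilde x^{s+1}=\big(\sum_{k=0}^{n-1}\theta_3^k\big)^{-1}\sum_{k=0}^{n-1}\theta_3^k x^s_k$, and $c\le 5\gamma L+\frac{95}{8}\tau^2\gamma L\le 1$. If $F(0)-F(x^*)\le M$ and $0<\epsilon\le M/2$, then for some such $S$ the algorithm reaches $\mathbb E\,F(\tilde x^{S+1})-F(x^*)\le\epsilon$ with at most $$C\left(n+\tau\sqrt{nL/\mu}\,\log(M/\epsilon)\right)$$ IFO calls. That is, for bounded $M$ it needs $O\big(n+\tau\sqrt{nL/\mu}\,\log(1/\epsilon)\big)$ calls. -/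

import Mathlib

open MeasureTheory ProbabilityTheory

noncomputable section

namespace AASVRG

/-- The result of a computation together with the number of oracle calls it has made. -/
structure Metered (α : Type*) where
  value : α
  calls : ℕ

/-- A computation that makes no oracle call. -/
def Metered.pure {α : Type*} (a : α) : Metered α := ⟨a, 0⟩

/-- Sequential composition; the numbers of oracle calls add up. -/
def Metered.bind {α β : Type*} (p : Metered α) (q : α → Metered β) : Metered β :=
  ⟨(q p.value).value, p.calls + (q p.value).calls⟩

/-- Run `n` computations and add up their values; the numbers of oracle calls add up. -/
def Metered.sum {V : Type*} [AddCommMonoid V] {n : ℕ} (p : Fin n → Metered V) : Metered V :=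
  ⟨∑ i, (p i).value, ∑ i, (p i).calls⟩

/-- A first-order oracle for `n` component functions: the query `(i, x)` is answered by the value
and the gradient of the `i`-th function at `x`. -/
abbrev Oracle (n : ℕ) (V : Type*) := Fin n → V → Metered (ℝ × V)

/-- The incremental first-order oracle (IFO) of `f₁, …, fₙ`: every query costs one call. -/
def ifo {n : ℕ} {V : Type*} [NormedAddCommGroup V] [InnerProductSpace ℝ V] [CompleteSpace V]
    (f : Fin n → V → ℝ) : Oracle n V :=
  fun i x => ⟨(f i x, gradient (f i) x), 1⟩

/-- The full gradient `(1/n) ∑ ∇fᵢ(x)`, computed with one query for every component. -/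
def fullGradient {n : ℕ} {V : Type*} [NormedAddCommGroup V] [InnerProductSpace ℝ V]
    (O : Oracle n V) (x : V) : Metered V :=
  (Metered.sum fun i => (O i x).bind fun r => Metered.pure r.2).bind fun g =>
    Metered.pure ((n : ℝ)⁻¹ • g)

/-- A global minimiser of `φ` (if there is one). -/
def argmin {V : Type*} [Nonempty V] (φ : V → ℝ) : V :=
  Classical.epsilon fun v => ∀ u, φ v ≤ φ u

/-- The momentum weight `θ₂ = 1/2` of the snapshot. -/
def theta2 : ℝ := 1 / 2

/-- The compensated extrapolation point that iteration `k` computes from the delayed iterate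
`x j`.  With `a = 1 - θ₂ - θ₁` it is `x_j + a (1 - a^(k-j+1)) / (1 - a) (x_j - x_{j-1})`.  For
`j = 0` the vector `a (x_0 - x_{-1})` stands for `p = y_0 - x_0` with
`y_0 = θ₁ z_0 + θ₂ x̃ + a x_0`, as in the identity `y_j - x_j = a (x_j - x_{j-1})` for `j ≥ 1`. -/
def compensated {V : Type*} [NormedAddCommGroup V] [InnerProductSpace ℝ V]
    (a : ℝ) (p : V) (x : ℕ → V) (k j : ℕ) : V :=
  if j = 0 then x 0 + ((1 - a ^ (k + 1)) / (1 - a)) • p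
  else x j + (a * (1 - a ^ (k - j + 1)) / (1 - a)) • (x j - x (j - 1))

/-- State inside an epoch after `k` iterations: the history `x 0, …, x k` and the current `z`. -/
structure InnerState (V : Type*) where
  x : ℕ → V
  z : V

/-- State at the start of an epoch: `x_0`, `z_0` and the snapshot `x̃`. -/
structure EpochState (V : Type*) where
  x : V
  z : V
  snap : V

/-- The first `k` asynchronous iterations of an epoch that starts in `st`.  Here `g` is the full
gradient at the snapshot, `i k` the sample drawn in iteration `k`, and `j k` the index of the
delayed iterate that iteration `k` reads. -/
def innerLoop {n : ℕ} {V : Type*} [NormedAddCommGroup V] [InnerProductSpace ℝ V]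
    (O : Oracle n V) (h : V → ℝ) (θ γ : ℝ) (st : EpochState V) (g : V)
    (i : ℕ → Fin n) (j : ℕ → ℕ) : ℕ → Metered (InnerState V)
  | 0 => Metered.pure ⟨fun _ => st.x, st.z⟩
  | k + 1 =>
    (innerLoop O h θ γ st g i j k).bind fun c =>
      let a : ℝ := 1 - theta2 - θ
      let y₀ : V := θ • st.z + theta2 • st.snap + a • st.x
      let w : V := compensated a (y₀ - st.x) c.x k (j k)
      (O (i k) w).bind fun r =>
      (O (i k) st.snap).bind fun r' =>
        let v : V := r.2 - r'.2 + g
        let δ : V := argmin fun δ => h (c.z + δ) + inner ℝ v δ + θ / (2 * γ) * ‖δ‖ ^ 2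
        let z' : V := c.z + δ
        let x' : V := θ • z' + theta2 • st.snap + a • c.x k
        Metered.pure ⟨Function.update c.x (k + 1) x', z'⟩

/-- One epoch of `n` asynchronous iterations followed by synchronisation.  The new snapshot is
computed from the iterates of the epoch by the rule `avg`. -/
def epoch {n : ℕ} {V : Type*} [NormedAddCommGroup V] [InnerProductSpace ℝ V]
    (O : Oracle n V) (h : V → ℝ) (avg : (ℕ → V) → V) (θ γ : ℝ)
    (i : ℕ → Fin n) (j : ℕ → ℕ) (st : EpochState V) : Metered (EpochState V) :=
  (fullGradient O st.snap).bind fun g =>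
    (innerLoop O h θ γ st g i j n).bind fun c =>
      Metered.pure ⟨c.x n, c.z, avg c.x⟩

/-- Accelerated asynchronous SVRG started at the origin: the state after `s` epochs.  Epoch `s`
uses the momentum weight `θ s`; its iteration `k` has the global number `s * n + k`, draws the
sample `i (s * n + k)` and reads the iterate number `j (s * n + k)` of the same epoch. -/
def aasvrg {n : ℕ} {V : Type*} [NormedAddCommGroup V] [InnerProductSpace ℝ V]
    (O : Oracle n V) (h : V → ℝ) (avg : (ℕ → V) → V) (θ : ℕ → ℝ) (γ : ℝ)
    (i : ℕ → Fin n) (j : ℕ → ℕ) : ℕ → Metered (EpochState V)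
  | 0 => Metered.pure ⟨0, 0, 0⟩
  | s + 1 =>
    (aasvrg O h avg θ γ i j s).bind fun st =>
      epoch O h avg (θ s) γ (fun k => i (s * n + k)) (fun k => j (s * n + k)) st

/-- Snapshot rule without strong convexity: the mean of the `n` iterates computed in the epoch. -/
def uniformAverage {V : Type*} [NormedAddCommGroup V] [InnerProductSpace ℝ V]
    (n : ℕ) (x : ℕ → V) : V :=
  (n : ℝ)⁻¹ • ∑ k ∈ Finset.range n, x (k + 1)

/-- Snapshot rule with strong convexity: `x_0, …, x_{n-1}` averaged with weights `ϑ ^ k`. -/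
def geometricAverage {V : Type*} [NormedAddCommGroup V] [InnerProductSpace ℝ V]
    (ϑ : ℝ) (n : ℕ) (x : ℕ → V) : V :=
  (∑ k ∈ Finset.range n, ϑ ^ k)⁻¹ • ∑ k ∈ Finset.range n, ϑ ^ k • x k

/-- The objective `F = h + (1/n) ∑ fᵢ`. -/
def objective {n : ℕ} {V : Type*} (f : Fin n → V → ℝ) (h : V → ℝ) (x : V) : ℝ :=
  h x + (n : ℝ)⁻¹ * ∑ i, f i x

/-- `f` is convex, differentiable, and its gradient is `L`-Lipschitz. -/
def ConvexSmooth {V : Type*} [NormedAddCommGroup V] [InnerProductSpace ℝ V] [CompleteSpace V]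
    (L : ℝ) (f : V → ℝ) : Prop :=
  ConvexOn ℝ Set.univ f ∧ Differentiable ℝ f ∧
    ∀ x y, ‖gradient f x - gradient f y‖ ≤ L * ‖x - y‖

/-- Random samples `I t` and read indices `J t` (with `t = s * n + k` for iteration `k` of epoch
`s`, and `ℱ t` the information available before iteration `t`): every sample is uniform on the `n`
components and independent of the past; the read index is determined by the past, is an earlier
iterate of the same epoch, and is at most `τ` iterations old. -/
structure AsyncSampling {Ω : Type*} {mΩ : MeasurableSpace Ω} (P : Measure Ω) (n τ : ℕ)
    (ℱ : Filtration ℕ mΩ) (I : ℕ → Ω → Fin n) (J : ℕ → Ω → ℕ) : Prop where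
  sample_measurable : ∀ t, Measurable[ℱ (t + 1)] (I t)
  sample_uniform : ∀ t i, P (I t ⁻¹' {i}) = (n : ENNReal)⁻¹
  sample_indep : ∀ t, Indep (ℱ t) (MeasurableSpace.comap (I t) ⊤) P
  read_measurable : ∀ t, Measurable[ℱ t] (J t)
  read_le : ∀ s k ω, k < n → J (s * n + k) ω ≤ k
  delay_le : ∀ s k ω, k < n → k ≤ J (s * n + k) ω + τ

/-- Started at the origin, after the epochs `0, …, S` the algorithm has made at most `B` calls of
the incremental first-order oracle, and its snapshot is `ε`-optimal in expectation (`Fmin` is the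
minimum of the objective), for all random samples and all delays bounded by `τ`. -/
def ReachesWithin.{u} {n : ℕ} {V : Type*} [NormedAddCommGroup V] [InnerProductSpace ℝ V]
    [CompleteSpace V] (f : Fin n → V → ℝ) (h : V → ℝ) (avg : (ℕ → V) → V) (θ : ℕ → ℝ) (γ : ℝ)
    (τ : ℕ) (Fmin ε B : ℝ) (S : ℕ) : Prop :=
  ∀ (Ω : Type u) (mΩ : MeasurableSpace Ω) (P : Measure Ω) (_ : IsProbabilityMeasure P)
    (ℱ : Filtration ℕ mΩ) (I : ℕ → Ω → Fin n) (J : ℕ → Ω → ℕ), AsyncSampling P n τ ℱ I J →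
    let out : Ω → Metered (EpochState V) := fun ω =>
      aasvrg (ifo f) h avg θ γ (fun t => I t ω) (fun t => J t ω) (S + 1)
    (∀ ω, ((out ω).calls : ℝ) ≤ B) ∧
    Integrable (fun ω => objective f h (out ω).value.snap) P ∧
    (∫ ω, objective f h (out ω).value.snap ∂P) - Fmin ≤ ε

end AASVRG

end

noncomputable section

namespace AASVRG

/-! ### Convex analysis: smoothness, co-coercivity and the proximal step. -/

section Analysis

/-! The proof is a potential argument for accelerated SVRG in which the delay error is paid for by
the movement of `z`.

One iteration. Write `D = F - F(x*)`, `d_k = z_{k+1} - z_k`, `ρ = 1 + μγ/θ` (with `μ = 0` in the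
first part). Smoothness at the read point `w`, convexity, and strong convexity of the proximal
subproblem give (`one_step`) `D(x_{k+1}) ≤ D(x̃)/2 + (1/2 - θ) D(x_k) + θ²/(2γ) (‖z_k - x*‖² -
ρ‖z_{k+1} - x*‖²)`, plus a noise term, minus `θ²(1/(2γ) - L)‖d_k‖²`, plus `L/2 ‖x_{k+1} - w‖²`. The
noise has nonpositive mean: by co-coercivity the variance of the reduced gradient is at most `2L`
times the Bregman distance from `w` to the snapshot, and the snapshot weight `1/2` leaves half of
that distance to absorb it (`sum_noise_nonpos`).

Delay. The read point is where `θz + x̃/2 + ax` would be had `z` stood still since iteration `j`.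
Hence `x_{k+1} - w` is controlled by `θ` times the at most `τ` increments of `z` missed since then
and the current one (`norm_extrapolation_error_le`). After squaring and summing over an epoch each
increment is charged at most `τ` times, so the total is at most `θ²(2 + 8κτ²) ∑ ρ^k ‖d_k‖²`, where
`κ` bounds the growth of `ρ^k` over a delay. The negative term absorbs this when `γL(4 + 8κτ²) ≤ 1`,
which the step-size conditions imply with `κ = 1` and `κ = 95/64`.

Epochs. Summing and applying Jensen to the snapshot makes a potential decrease in mean: with `θ =
2/t` it is nonincreasing and carries the factor `t²` (`AsyncSampling.sublinear_rate`); under strong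
convexity it contracts by `1 + β`, with `β` proportional to `θ` (`AsyncSampling.linear_rate`). An
epoch costs `3n` calls, so what remains is to choose the number of epochs.

Measurability is harmless: samples and read indices take finitely many values, hence so does every
state. -/

lemma argmin_spec {W : Type*} [Nonempty W] {φ : W → ℝ} (h : ∃ v, ∀ u, φ v ≤ φ u) (u : W) :
    φ (argmin φ) ≤ φ u :=
  Classical.epsilon_spec (p := fun v => ∀ u, φ v ≤ φ u) h u

variable {V : Type*} [NormedAddCommGroup V] [InnerProductSpace ℝ V]

section Smooth

variable [CompleteSpace V] {L : ℝ} {f : V → ℝ}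

lemma ConvexSmooth.hasDerivAt_line (hf : ConvexSmooth L f) (x d : V) (t : ℝ) :
    HasDerivAt (fun s : ℝ => f (x + s • d)) (inner ℝ (gradient f (x + t • d)) d) t := by
  have h1 : HasFDerivAt f (fderiv ℝ f (x + t • d)) (x + t • d) :=
    (hf.2.1 _).hasFDerivAt
  have h2 : HasDerivAt (fun s : ℝ => x + s • d) d t := by
    simpa using ((hasDerivAt_id t).smul_const d).const_add x
  have h3 := h1.comp_hasDerivAt t h2
  rw [inner_gradient_left]
  exact h3

lemma ConvexSmooth.add_inner_le (hf : ConvexSmooth L f) (x y : V) :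
    f x + inner ℝ (gradient f x) (y - x) ≤ f y := by
  have hc : ConvexOn ℝ Set.univ (fun s : ℝ => f (x + s • (y - x))) := by
    have := hf.1.comp_affineMap (AffineMap.lineMap x y : ℝ →ᵃ[ℝ] V)
    simpa [Function.comp_def, AffineMap.lineMap_apply, add_comm] using this
  have hd := hf.hasDerivAt_line x (y - x) 0
  have := hc.le_slope_of_hasDerivAt (Set.mem_univ 0) (Set.mem_univ 1) one_pos hd
  simp [slope_def_field, -inner_gradient_left] at this
  linarith

lemma ConvexSmooth.le_add_inner_add (hf : ConvexSmooth L f) (x y : V) :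
    f y ≤ f x + inner ℝ (gradient f x) (y - x) + L / 2 * ‖y - x‖ ^ 2 := by
  set d := y - x with hd
  set φ : ℝ → ℝ := fun t => f (x + t • d) - t * inner ℝ (gradient f x) d
    - L / 2 * ‖d‖ ^ 2 * t ^ 2 with hφ
  have hder : ∀ t, HasDerivAt φ (inner ℝ (gradient f (x + t • d)) d
      - inner ℝ (gradient f x) d - L / 2 * ‖d‖ ^ 2 * (2 * t)) t := by
    intro t
    have h1 := hf.hasDerivAt_line x d t
    have h2 := (hasDerivAt_id t).mul_const (inner ℝ (gradient f x) d)
    have h3 := (hasDerivAt_pow 2 t).const_mul (L / 2 * ‖d‖ ^ 2)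
    simpa only [id, one_mul, pow_one, Nat.cast_ofNat, Nat.add_one_sub_one] using
      (h1.fun_sub h2).fun_sub h3
  have hanti : AntitoneOn φ (Set.Icc 0 1) := by
    refine antitoneOn_of_deriv_nonpos (convex_Icc 0 1)
      (fun t _ => (hder t).continuousAt.continuousWithinAt)
      (fun t _ => (hder t).differentiableAt.differentiableWithinAt) ?_
    intro t ht
    rw [interior_Icc] at ht
    rw [(hder t).deriv, ← inner_sub_left]
    have h1 := real_inner_le_norm (gradient f (x + t • d) - gradient f x) d
    have h2 := hf.2.2 (x + t • d) x
    rw [add_sub_cancel_left, norm_smul, Real.norm_of_nonneg ht.1.le] at h2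
    nlinarith [norm_nonneg d, mul_le_mul_of_nonneg_right h2 (norm_nonneg d)]
  have := hanti (Set.left_mem_Icc.2 zero_le_one) (Set.right_mem_Icc.2 zero_le_one) zero_le_one
  simp [hφ, -inner_gradient_left] at this
  rw [hd, add_sub_cancel] at this
  rw [hd]
  linarith

/-- Co-coercivity: at the test point `y + L⁻¹ g`, with `g` the gradient difference, the tangent at
`x` bounds `f` from below and the quadratic model at `y` bounds it from above. -/
lemma ConvexSmooth.norm_gradient_sub_sq_le (hL : 0 < L) (hf : ConvexSmooth L f) (x y : V) :
    ‖gradient f x - gradient f y‖ ^ 2 ≤ 2 * L * (f y - f x - inner ℝ (gradient f x) (y - x)) := by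
  set g := gradient f x - gradient f y with hg
  have h1 := hf.add_inner_le x (y + L⁻¹ • g)
  have h2 := hf.le_add_inner_add y (y + L⁻¹ • g)
  have e1 : y + L⁻¹ • g - x = (y - x) + L⁻¹ • g := by abel
  rw [e1, inner_add_right, inner_smul_right] at h1
  rw [add_sub_cancel_left, inner_smul_right, norm_smul, Real.norm_of_nonneg (by positivity)] at h2
  have h3 : inner ℝ (gradient f x) g - inner ℝ (gradient f y) g = ‖g‖ ^ 2 := by
    rw [← inner_sub_left, ← hg, real_inner_self_eq_norm_sq]
  have h4 : L / 2 * (L⁻¹ * ‖g‖) ^ 2 = L⁻¹ * ‖g‖ ^ 2 / 2 := by field_simp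
  have h5 : L⁻¹ * ‖g‖ ^ 2 ≤ 2 * (f y - f x - inner ℝ (gradient f x) (y - x)) := by
    rw [← h3] at h4 ⊢
    nlinarith
  rw [inv_mul_le_iff₀ hL] at h5
  linarith

end Smooth

lemma strongConvexOn_add_norm_sq_le_of_isMin {m : ℝ} {φ : V → ℝ} (hφ : StrongConvexOn Set.univ m φ)
    {x : V} (hx : ∀ u, φ x ≤ φ u) (u : V) : φ x + m / 2 * ‖u - x‖ ^ 2 ≤ φ u := by
  have key : ∀ t ∈ Set.Ioo (0 : ℝ) 1, φ x + (1 - t) * (m / 2 * ‖u - x‖ ^ 2) ≤ φ u := by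
    intro t ht
    have h1 := hφ.2 (Set.mem_univ u) (Set.mem_univ x) ht.1.le (sub_nonneg.2 ht.2.le) (by ring)
    have h2 := hx (t • u + (1 - t) • x)
    simp only [smul_eq_mul] at h1
    have h3 : t * (φ x + (1 - t) * (m / 2 * ‖u - x‖ ^ 2)) ≤ t * φ u := by nlinarith
    exact le_of_mul_le_mul_left h3 ht.1
  have hlim : Filter.Tendsto (fun t : ℝ => φ x + (1 - t) * (m / 2 * ‖u - x‖ ^ 2))
      (nhdsWithin 0 (Set.Ioi 0)) (nhds (φ x + (1 - 0) * (m / 2 * ‖u - x‖ ^ 2))) := by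
    refine Filter.Tendsto.mono_left ?_ nhdsWithin_le_nhds
    exact Continuous.tendsto (by fun_prop) 0
  have := le_of_tendsto hlim (Filter.eventually_of_mem (Ioo_mem_nhdsGT zero_lt_one) key)
  simpa using this

/-- Since `h` need not be bounded below, this is what makes the proximal objective coercive. Outside
the unit ball, convexity on the segment from `0` to `x` through `x/‖x‖` transfers the bound from the
ball. -/
lemma convexOn_exists_linear_lower_bound [FiniteDimensional ℝ V] {h : V → ℝ}
    (hh : ConvexOn ℝ Set.univ h) : ∃ K : ℝ, 0 ≤ K ∧ ∀ x, -K * (1 + ‖x‖) ≤ h x := by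
  have hcont : Continuous h := hh.locallyLipschitz.continuous
  obtain ⟨K₀, hK₀⟩ := (isCompact_closedBall (0 : V) 1).exists_bound_of_continuousOn
    hcont.continuousOn
  have hK0 : 0 ≤ K₀ := (norm_nonneg _).trans (hK₀ 0 (by simp))
  refine ⟨2 * K₀, by positivity, fun x => ?_⟩
  have h0 : |h 0| ≤ K₀ := hK₀ 0 (by simp)
  rw [abs_le] at h0
  rcases le_or_gt ‖x‖ 1 with hx | hx
  · have h1 : |h x| ≤ K₀ := hK₀ x (by simpa using hx)
    rw [abs_le] at h1
    nlinarith [norm_nonneg x, mul_nonneg hK0 (norm_nonneg x)]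
  · have hpos : 0 < ‖x‖ := by linarith
    have h1 : |h (‖x‖⁻¹ • x)| ≤ K₀ := hK₀ _ (by
      simp [norm_smul, inv_mul_cancel₀ hpos.ne'])
    rw [abs_le] at h1
    have h2 := hh.2 (Set.mem_univ x) (Set.mem_univ 0) (inv_nonneg.2 hpos.le)
      (sub_nonneg.2 (inv_le_one_of_one_le₀ hx.le)) (by ring)
    simp only [smul_eq_mul, smul_zero, add_zero] at h2
    have h3 : ‖x‖ * h (‖x‖⁻¹ • x) ≤ h x + (‖x‖ - 1) * h 0 := by
      have := mul_le_mul_of_nonneg_left h2 hpos.le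
      have e : ‖x‖ * (‖x‖⁻¹ * h x + (1 - ‖x‖⁻¹) * h 0) = h x + (‖x‖ - 1) * h 0 := by
        field_simp
      linarith
    nlinarith

lemma exists_prox [FiniteDimensional ℝ V] {h : V → ℝ} (hh : ConvexOn ℝ Set.univ h) (z v : V)
    {η : ℝ} (hη : 0 < η) :
    ∃ δ, ∀ u, h (z + δ) + inner ℝ v δ + η * ‖δ‖ ^ 2 ≤ h (z + u) + inner ℝ v u + η * ‖u‖ ^ 2 := by
  have hcont : Continuous h := hh.locallyLipschitz.continuous
  obtain ⟨K, hK0, hK⟩ := convexOn_exists_linear_lower_bound hh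
  refine Continuous.exists_forall_le (f := fun δ => h (z + δ) + inner ℝ v δ + η * ‖δ‖ ^ 2)
    (by fun_prop) ?_
  have hbound : ∀ δ : V, ‖δ‖ * (η * ‖δ‖ - (K + ‖v‖)) - K * (1 + ‖z‖) ≤
      h (z + δ) + inner ℝ v δ + η * ‖δ‖ ^ 2 := by
    intro δ
    have h1 := hK (z + δ)
    have h2 := neg_le_of_abs_le (abs_real_inner_le_norm v δ)
    nlinarith [norm_add_le z δ]
  refine Filter.tendsto_atTop_mono hbound ?_
  refine Filter.tendsto_atTop_add_const_right _ _ ?_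
  have hn := tendsto_norm_cocompact_atTop (E := V)
  refine hn.atTop_mul_atTop₀ ?_
  exact Filter.tendsto_atTop_add_const_right _ _ (hn.const_mul_atTop hη)

lemma norm_sq_strongConvexOn (m : ℝ) :
    StrongConvexOn Set.univ (2 * m) (fun x : V => m * ‖x‖ ^ 2) := by
  rw [strongConvexOn_iff_convex]
  simpa using convexOn_const (0 : ℝ) convex_univ

/-- The subproblem is `(μ + 2η)`-strongly convex, so it grows quadratically away from its minimiser;
the growth is tested at the displacement `u - z`. -/
lemma prox_inequality [FiniteDimensional ℝ V] {h : V → ℝ} {μ : ℝ} (hμ : 0 ≤ μ)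
    (hh : StrongConvexOn Set.univ μ h) (z v u : V) {η : ℝ} (hη : 0 < η) {δ : V}
    (hδ : δ = argmin fun δ => h (z + δ) + inner ℝ v δ + η * ‖δ‖ ^ 2) :
    h (z + δ) + inner ℝ v (z + δ - u) + η * ‖δ‖ ^ 2 + (η + μ / 2) * ‖z + δ - u‖ ^ 2 ≤
      h u + η * ‖z - u‖ ^ 2 := by
  have hc : ConvexOn ℝ Set.univ h := strongConvexOn_zero.1 (hh.mono hμ)
  have hmin := argmin_spec (exists_prox hc z v hη)
  rw [← hδ] at hmin
  have hsc : StrongConvexOn Set.univ (μ + 2 * η)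
      (fun δ => h (z + δ) + inner ℝ v δ + η * ‖δ‖ ^ 2) := by
    refine ⟨convex_univ, fun x _ y _ a b ha hb hab => ?_⟩
    have h1 := hh.2 (Set.mem_univ (z + x)) (Set.mem_univ (z + y)) ha hb hab
    have h2 := (norm_sq_strongConvexOn (V := V) η).2 (Set.mem_univ x) (Set.mem_univ y) ha hb hab
    have e1 : a • (z + x) + b • (z + y) = z + (a • x + b • y) := by
      rw [smul_add, smul_add]
      calc _ = (a + b) • z + (a • x + b • y) := by rw [add_smul]; abel
        _ = _ := by rw [hab, one_smul]
    rw [e1, add_sub_add_left_eq_sub] at h1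
    simp only [smul_eq_mul, inner_add_right, inner_smul_right] at h1 h2 ⊢
    nlinarith
  have := strongConvexOn_add_norm_sq_le_of_isMin hsc hmin (u - z)
  rw [add_sub_cancel] at this
  have e2 : ‖u - z - δ‖ = ‖z + δ - u‖ := by rw [← norm_neg]; congr 1; abel
  have e3 : ‖u - z‖ = ‖z - u‖ := norm_sub_rev _ _
  have e4 : z + δ - u = δ - (u - z) := by abel
  rw [e2, e3] at this
  have e5 : inner ℝ v (z + δ - u) = inner ℝ v δ - inner ℝ v (u - z) := by
    rw [e4, inner_sub_right]
  rw [e5]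
  nlinarith

end Analysis

lemma convexOn_combination {V : Type*} [AddCommGroup V] [Module ℝ V] {h : V → ℝ} (hh : ConvexOn ℝ Set.univ h) {a b c : ℝ} (ha : 0 ≤ a)
    (hb : 0 ≤ b) (hc : 0 ≤ c) (habc : a + b + c = 1) (x y z : V) :
    h (a • x + b • y + c • z) ≤ a * h x + b * h y + c * h z := by
  have := hh.map_sum_le (t := Finset.univ) (w := ![a, b, c]) (p := ![x, y, z])
    (by simp [Fin.forall_fin_succ, ha, hb, hc]) (by simp [Fin.sum_univ_succ]; linarith) (by simp)
  simpa [Fin.sum_univ_succ, add_assoc] using this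

/-! ### One iteration: variance reduction and the basic estimate. -/

section Step

variable {V : Type*} [NormedAddCommGroup V] [InnerProductSpace ℝ V] [CompleteSpace V]
  {n : ℕ}

/-- The gradient of the finite-sum part of the objective. -/
def meanGradient (f : Fin n → V → ℝ) (x : V) : V := (n : ℝ)⁻¹ • ∑ i, gradient (f i) x

/-- The variance-reduced gradient estimator at `w` with snapshot `y` and sample `i`. -/
def reducedGradient (f : Fin n → V → ℝ) (y w : V) (i : Fin n) : V :=
  gradient (f i) w - gradient (f i) y + meanGradient f y

/-- The Bregman distance of the finite-sum part from `w` to `y`. -/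
def bregman (f : Fin n → V → ℝ) (y w : V) : ℝ :=
  (n : ℝ)⁻¹ * ∑ i, f i y - (n : ℝ)⁻¹ * ∑ i, f i w - inner ℝ (meanGradient f w) (y - w)

/-- The stochastic error of one iteration; its mean over the samples is nonpositive. -/
def noise (L θ : ℝ) (f : Fin n → V → ℝ) (u z y w : V) (i : Fin n) : ℝ :=
  θ * inner ℝ (meanGradient f w - reducedGradient f y w i) (z - u)
    + ‖meanGradient f w - reducedGradient f y w i‖ ^ 2 / (4 * L) - bregman f y w / 2

lemma inner_meanGradient (f : Fin n → V → ℝ) (x d : V) :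
    inner ℝ (meanGradient f x) d = (n : ℝ)⁻¹ * ∑ i, inner ℝ (gradient (f i) x) d := by
  rw [meanGradient, real_inner_smul_left, sum_inner]

lemma mean_add_inner_le {L : ℝ} {f : Fin n → V → ℝ} (hf : ∀ i, ConvexSmooth L (f i)) (x y : V) :
    (n : ℝ)⁻¹ * ∑ i, f i x + inner ℝ (meanGradient f x) (y - x) ≤ (n : ℝ)⁻¹ * ∑ i, f i y := by
  rw [inner_meanGradient, ← mul_add, ← Finset.sum_add_distrib]
  gcongr with i
  exact (hf i).add_inner_le x y

lemma mean_le_add_inner_add (hn : 0 < n) {L : ℝ} {f : Fin n → V → ℝ}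
    (hf : ∀ i, ConvexSmooth L (f i)) (x y : V) :
    (n : ℝ)⁻¹ * ∑ i, f i y ≤ (n : ℝ)⁻¹ * ∑ i, f i x + inner ℝ (meanGradient f x) (y - x)
      + L / 2 * ‖y - x‖ ^ 2 := by
  have hn' : (n : ℝ) ≠ 0 := by positivity
  have h := Finset.sum_le_sum fun i (_ : i ∈ Finset.univ) => (hf i).le_add_inner_add x y
  rw [Finset.sum_add_distrib, Finset.sum_add_distrib, Finset.sum_const, Finset.card_univ,
    Fintype.card_fin, nsmul_eq_mul] at h
  have h' := mul_le_mul_of_nonneg_left h (inv_nonneg.2 (Nat.cast_nonneg (α := ℝ) n))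
  rw [inner_meanGradient]
  rw [mul_add, mul_add, inv_mul_cancel_left₀ hn'] at h'
  exact h'

/-- The errors sum to zero, which kills the inner product because `z` does not depend on `i`. A
variance is at most the second moment, and co-coercivity bounds the latter by the Bregman distance.
-/
lemma sum_noise_nonpos (hn : 0 < n) {L : ℝ} (hL : 0 < L) {f : Fin n → V → ℝ}
    (hf : ∀ i, ConvexSmooth L (f i)) (θ : ℝ) (u z y w : V) :
    ∑ i, noise L θ f u z y w i ≤ 0 := by
  have hn' : (n : ℝ) ≠ 0 := by positivity
  set g : Fin n → V := fun i => gradient (f i) w - gradient (f i) y with hg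
  set m : V := (n : ℝ)⁻¹ • ∑ i, g i with hm
  have hsum : ∑ i, g i = (n : ℝ) • m := by rw [hm, smul_inv_smul₀ hn']
  have he : ∀ i, meanGradient f w - reducedGradient f y w i = m - g i := by
    intro i
    have : m = meanGradient f w - meanGradient f y := by
      rw [hm, hg, Finset.sum_sub_distrib, smul_sub]; rfl
    rw [this, reducedGradient]
    simp only [hg]
    abel
  have h1 : ∑ i, (m - g i) = 0 := by
    rw [Finset.sum_sub_distrib, hsum]
    simp [← Nat.cast_smul_eq_nsmul ℝ]
  have h2 : ∑ i, ‖m - g i‖ ^ 2 ≤ ∑ i, ‖g i‖ ^ 2 := by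
    have e : ∀ i, ‖m - g i‖ ^ 2 = ‖m‖ ^ 2 - 2 * inner ℝ m (g i) + ‖g i‖ ^ 2 := fun i =>
      norm_sub_sq_real _ _
    simp_rw [e]
    rw [Finset.sum_add_distrib, Finset.sum_sub_distrib, ← Finset.mul_sum, ← inner_sum, hsum,
      inner_smul_right, real_inner_self_eq_norm_sq]
    simp only [Finset.sum_const, Finset.card_univ, Fintype.card_fin, nsmul_eq_mul]
    have : 0 ≤ (n : ℝ) * ‖m‖ ^ 2 := by positivity
    linarith
  have h3 : ∑ i, ‖g i‖ ^ 2 ≤ 2 * L * (n * bregman f y w) := by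
    have e : (n : ℝ) * bregman f y w
        = ∑ i, (f i y - f i w - inner ℝ (gradient (f i) w) (y - w)) := by
      rw [bregman, inner_meanGradient, Finset.sum_sub_distrib, Finset.sum_sub_distrib]
      field_simp
    rw [e, Finset.mul_sum]
    exact Finset.sum_le_sum fun i _ => (hf i).norm_gradient_sub_sq_le hL w y
  have h4 : ∑ i, noise L θ f u z y w i
      = θ * inner ℝ (∑ i, (m - g i)) (z - u) + (∑ i, ‖m - g i‖ ^ 2) / (4 * L)
        - n * bregman f y w / 2 := by
    simp only [noise, he]
    rw [Finset.sum_sub_distrib, Finset.sum_add_distrib, ← Finset.mul_sum, sum_inner,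
      Finset.sum_div]
    simp
    ring
  rw [h4, h1, inner_zero_left, mul_zero, zero_add]
  have h5 : (∑ i, ‖m - g i‖ ^ 2) / (4 * L) ≤ n * bregman f y w / 2 := by
    rw [div_le_iff₀ (by positivity)]
    linarith
  linarith

variable [FiniteDimensional ℝ V]

lemma one_step (hn : 0 < n) {L μ γ θ a : ℝ} (hL : 0 < L) (hμ : 0 ≤ μ) (hγ : 0 < γ) (hθ : 0 < θ)
    (ha0 : 0 ≤ a) (ha : θ + 1 / 2 + a = 1) {f : Fin n → V → ℝ} (hf : ∀ i, ConvexSmooth L (f i))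
    {h : V → ℝ} (hh : StrongConvexOn Set.univ μ h) (u x y z w δ x' : V) (i : Fin n)
    (hδ : δ = argmin fun δ => h (z + δ) + inner ℝ (reducedGradient f y w i) δ
      + θ / (2 * γ) * ‖δ‖ ^ 2)
    (hx' : x' = θ • (z + δ) + (1 / 2 : ℝ) • y + a • x) :
    objective f h x' - objective f h u ≤ 1 / 2 * (objective f h y - objective f h u)
      + a * (objective f h x - objective f h u)
      + θ ^ 2 / (2 * γ) * (‖z - u‖ ^ 2 - (1 + μ * γ / θ) * ‖z + δ - u‖ ^ 2)
      + noise L θ f u z y w i - θ ^ 2 * (1 / (2 * γ) - L) * ‖δ‖ ^ 2 + L / 2 * ‖x' - w‖ ^ 2 := by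
  have hc : ConvexOn ℝ Set.univ h := strongConvexOn_zero.1 (hh.mono hμ)
  have hprox := prox_inequality hμ hh z (reducedGradient f y w i) u (by positivity) hδ
  have hsm := mean_le_add_inner_add hn hf w x'
  have hu := mean_add_inner_le hf w u
  have hx := mean_add_inner_le hf w x
  have hcomb := convexOn_combination hc hθ.le (by norm_num : (0 : ℝ) ≤ 1 / 2) ha0 ha (z + δ) y x
  rw [← hx'] at hcomb
  set e := meanGradient f w - reducedGradient f y w i with he
  set v := reducedGradient f y w i with hv
  have hG : meanGradient f w = e + v := by rw [he]; abel
  -- The `u` and `x` parts will use convexity and drop their Bregman distances; the snapshot part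
  -- keeps its distance exactly, to compensate the variance in `noise`.
  have hsplit : x' - w = θ • (z + δ - u) + θ • (u - w) + (1 / 2 : ℝ) • (y - w) + a • (x - w) := by
    have hw : w = θ • w + (1 / 2 : ℝ) • w + a • w := by rw [← add_smul, ← add_smul, ha, one_smul]
    rw [hx']
    nth_rewrite 1 [hw]
    module
  have hin : inner ℝ (meanGradient f w) (x' - w) = θ * inner ℝ v (z + δ - u)
      + θ * inner ℝ e (z - u) + θ * inner ℝ e δ + θ * inner ℝ (meanGradient f w) (u - w)
      + 1 / 2 * inner ℝ (meanGradient f w) (y - w) + a * inner ℝ (meanGradient f w) (x - w) := by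
    rw [hsplit]
    simp only [inner_add_right, inner_smul_right]
    have : inner ℝ (meanGradient f w) (z + δ - u)
        = inner ℝ v (z + δ - u) + inner ℝ e (z - u) + inner ℝ e δ := by
      have e2 : z + δ - u = (z - u) + δ := by abel
      rw [hG, inner_add_left, add_assoc, ← inner_add_right, ← e2]
      ring
    rw [this]
    ring
  -- The increment `δ` depends on the sample, so its correlation with the error has no zero mean and
  -- goes through Young's inequality; this is the origin of the `L` in `1 / (2 * γ) - L`.
  have hyoung : θ * inner ℝ e δ ≤ θ ^ 2 * L * ‖δ‖ ^ 2 + ‖e‖ ^ 2 / (4 * L) := by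
    have h1 := real_inner_le_norm e δ
    have h2 : θ ^ 2 * L * ‖δ‖ ^ 2 + ‖e‖ ^ 2 / (4 * L) - θ * (‖e‖ * ‖δ‖)
        = (2 * L * θ * ‖δ‖ - ‖e‖) ^ 2 / (4 * L) := by field_simp; ring
    have h3 : 0 ≤ (2 * L * θ * ‖δ‖ - ‖e‖) ^ 2 / (4 * L) := by positivity
    have := mul_le_mul_of_nonneg_left h1 hθ.le
    linarith
  have hp := mul_le_mul_of_nonneg_left hprox hθ.le
  have ep : θ * (h (z + δ) + inner ℝ v (z + δ - u) + θ / (2 * γ) * ‖δ‖ ^ 2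
      + (θ / (2 * γ) + μ / 2) * ‖z + δ - u‖ ^ 2) = θ * h (z + δ) + θ * inner ℝ v (z + δ - u)
      + θ ^ 2 * (1 / (2 * γ)) * ‖δ‖ ^ 2
      + θ ^ 2 / (2 * γ) * ((1 + μ * γ / θ) * ‖z + δ - u‖ ^ 2) := by
    field_simp
  have ep2 : θ * (h u + θ / (2 * γ) * ‖z - u‖ ^ 2) = θ * h u + θ ^ 2 / (2 * γ) * ‖z - u‖ ^ 2 := by
    field_simp
  rw [ep, ep2] at hp
  have hu' := mul_le_mul_of_nonneg_left hu hθ.le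
  have hx'' := mul_le_mul_of_nonneg_left hx ha0
  simp only [objective, noise, bregman]
  rw [hin] at hsm
  have ha' : a = 1 / 2 - θ := by linarith
  subst ha'
  nlinarith

end Step

/-! ### Deterministic control of delays. -/

section Delay

/-- After exchanging the sums, each `q i` lies in at most `τ` windows, and moving the weight from
`k` to `i` costs `ρ ^ (k - i) ≤ κ`. Both `k - i ≤ τ` and `k - i ≤ n` hold, so no relation between
`τ` and `n` is needed. -/
lemma weighted_delay_sum_le {n τ : ℕ} {ρ κ : ℝ} (hρ : 0 ≤ ρ)
    (hκ : ∀ m, m ≤ τ → m ≤ n → ρ ^ m ≤ κ) {q : ℕ → ℝ} (hq : ∀ i, 0 ≤ q i) :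
    ∑ k ∈ Finset.range n, ρ ^ k * ∑ i ∈ Finset.Ico (k - τ) k, q i
      ≤ κ * τ * ∑ k ∈ Finset.range n, ρ ^ k * q k := by
  have hκ0 : 0 ≤ κ := by simpa using zero_le_one.trans (hκ 0 τ.zero_le n.zero_le)
  calc ∑ k ∈ Finset.range n, ρ ^ k * ∑ i ∈ Finset.Ico (k - τ) k, q i
      ≤ ∑ k ∈ Finset.range n, ∑ i ∈ Finset.Ico (k - τ) k, κ * (ρ ^ i * q i) := by
        refine Finset.sum_le_sum fun k hk => ?_
        rw [Finset.mul_sum]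
        refine Finset.sum_le_sum fun i hi => ?_
        rw [Finset.mem_Ico] at hi
        rw [Finset.mem_range] at hk
        have h1 := hκ (k - i) (by omega) (by omega)
        have h2 : ρ ^ k = ρ ^ (k - i) * ρ ^ i := by rw [← pow_add]; congr 1; omega
        rw [h2, mul_assoc]
        exact mul_le_mul_of_nonneg_right h1 (mul_nonneg (pow_nonneg hρ _) (hq i))
    _ = ∑ i ∈ Finset.range n, ∑ k ∈ (Finset.range n).filter (fun k => i ∈ Finset.Ico (k - τ) k),
          κ * (ρ ^ i * q i) := by
        refine Finset.sum_comm' fun k i => ?_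
        simp only [Finset.mem_range, Finset.mem_Ico, Finset.mem_filter]
        omega
    _ ≤ ∑ i ∈ Finset.range n, τ * (κ * (ρ ^ i * q i)) := by
        gcongr with i hi
        rw [Finset.sum_const, nsmul_eq_mul]
        refine mul_le_mul_of_nonneg_right ?_ (by have := hq i; positivity)
        have hsub : (Finset.range n).filter (fun k => i ∈ Finset.Ico (k - τ) k)
            ⊆ Finset.Ioc i (i + τ) := by
          intro k
          simp only [Finset.mem_filter, Finset.mem_Ico, Finset.mem_Ioc]
          omega
        have := Finset.card_le_card hsub
        rw [Nat.card_Ioc, add_tsub_cancel_left] at this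
        exact_mod_cast this
    _ = κ * τ * ∑ k ∈ Finset.range n, ρ ^ k * q k := by
        rw [Finset.mul_sum]
        exact Finset.sum_congr rfl fun i _ => by ring

variable {V : Type*} [NormedAddCommGroup V] [InnerProductSpace ℝ V]

/-- Without increments `d`, the residual shrinks by `a` per step and the extrapolation is an exact
geometric sum. Each `d i` then enters linearly with a coefficient at most `θ / (1 - a) ≤ 2θ`. The
induction keeps the target `j + m` fixed and moves the starting index. -/
lemma norm_extrapolation_error_le {a θ : ℝ} (ha0 : 0 ≤ a) (ha : a ≤ 1 / 2) (hθ : 0 ≤ θ)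
    {x r d : ℕ → V} {n : ℕ} (hx : ∀ k < n, x (k + 1) = x k + r k + θ • d k)
    (hr : ∀ k < n, r (k + 1) = a • (r k + θ • d k)) (m : ℕ) :
    ∀ j, j + m ≤ n → ‖x (j + m) + r (j + m) - (x j + ((1 - a ^ (m + 1)) / (1 - a)) • r j)‖
      ≤ 2 * θ * ∑ i ∈ Finset.Ico j (j + m), ‖d i‖ := by
  have ha1 : 1 - a ≠ 0 := by linarith
  induction m with
  | zero =>
    intro j _
    simp [div_self ha1]
  | succ m ih =>
    intro j hj
    have h1 := ih (j + 1) (by omega)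
    have e1 : j + 1 + m = j + (m + 1) := by omega
    rw [e1] at h1
    rw [Finset.sum_eq_sum_Ico_succ_bot (by omega)]
    have hS : (1 - a ^ (m + 1 + 1)) / (1 - a) = 1 + (1 - a ^ (m + 1)) / (1 - a) * a := by
      field_simp; ring
    have e2 : x (j + 1) + ((1 - a ^ (m + 1)) / (1 - a)) • r (j + 1)
        - (x j + ((1 - a ^ (m + 1 + 1)) / (1 - a)) • r j)
        = ((1 - a ^ (m + 1 + 1)) / (1 - a) * θ) • d j := by
      rw [hS, hx j (by omega), hr j (by omega)]
      module
    have hS0 : 0 ≤ (1 - a ^ (m + 1 + 1)) / (1 - a) :=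
      div_nonneg (sub_nonneg.2 (pow_le_one₀ ha0 (by linarith))) (by linarith)
    have hS2 : (1 - a ^ (m + 1 + 1)) / (1 - a) ≤ 2 := by
      rw [div_le_iff₀ (by linarith)]
      have : 0 ≤ a ^ (m + 1 + 1) := pow_nonneg ha0 _
      linarith
    have h3 : ‖((1 - a ^ (m + 1 + 1)) / (1 - a) * θ) • d j‖ ≤ 2 * θ * ‖d j‖ := by
      rw [norm_smul, Real.norm_of_nonneg (mul_nonneg hS0 hθ)]
      gcongr
    have h4 := norm_add_le
      (x (j + (m + 1)) + r (j + (m + 1)) - (x (j + 1) + ((1 - a ^ (m + 1)) / (1 - a)) • r (j + 1)))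
      (((1 - a ^ (m + 1 + 1)) / (1 - a) * θ) • d j)
    rw [← e2, sub_add_sub_cancel, e2] at h4
    linarith

end Delay

/-! ### An epoch as a deterministic recursion. -/

section

variable {V : Type*} [NormedAddCommGroup V] [InnerProductSpace ℝ V] [CompleteSpace V]
  {n : ℕ}

/-- The iterates `x`, `z` of one epoch with snapshot `y`, samples `i`, read indices `j` and
extrapolated read points `w`. -/
structure IsEpochRun (f : Fin n → V → ℝ) (h : V → ℝ) (θ γ : ℝ) (τ : ℕ) (y : V) (i : ℕ → Fin n)
    (j : ℕ → ℕ) (x z w : ℕ → V) : Prop where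
  z_succ : ∀ k < n, z (k + 1) = z k + argmin fun δ =>
    h (z k + δ) + inner ℝ (reducedGradient f y (w k) (i k)) δ + θ / (2 * γ) * ‖δ‖ ^ 2
  x_succ : ∀ k < n, x (k + 1) = θ • z (k + 1) + theta2 • y + (1 - theta2 - θ) • x k
  read : ∀ k < n, w k = compensated (1 - theta2 - θ)
    (θ • z 0 + theta2 • y + (1 - theta2 - θ) • x 0 - x 0) x k (j k)
  read_le : ∀ k < n, j k ≤ k
  delay_le : ∀ k < n, k ≤ j k + τ

namespace IsEpochRun

variable {f : Fin n → V → ℝ} {h : V → ℝ} {θ γ : ℝ} {τ : ℕ} {y : V} {i : ℕ → Fin n}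
  {j : ℕ → ℕ} {x z w : ℕ → V}

lemma norm_sub_read_le (hrun : IsEpochRun f h θ γ τ y i j x z w) (hθ0 : 0 ≤ θ) (hθ : θ ≤ 1 / 2)
    {k : ℕ} (hk : k < n) :
    ‖x (k + 1) - w k‖
      ≤ θ * (‖z (k + 1) - z k‖ + 2 * ∑ l ∈ Finset.Ico (k - τ) k, ‖z (l + 1) - z l‖) := by
  set a : ℝ := 1 - theta2 - θ with ha
  have ha0 : 0 ≤ a := by simp only [ha, theta2]; linarith
  have ha2 : a ≤ 1 / 2 := by simp only [ha, theta2]; linarith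
  set r : ℕ → V := fun k => θ • z k + theta2 • y + a • x k - x k with hr
  set d : ℕ → V := fun k => z (k + 1) - z k with hd
  have hx1 : ∀ k < n, x (k + 1) = x k + r k + θ • d k := by
    intro k hk
    rw [hrun.x_succ k hk]
    simp only [hr, hd]
    module
  have hr1 : ∀ k < n, r (k + 1) = a • (r k + θ • d k) := by
    intro k hk
    have h1 : r k + θ • d k = x (k + 1) - x k := by rw [hx1 k hk]; abel
    rw [h1]
    have h2 : r (k + 1) = θ • z (k + 1) + theta2 • y + a • x (k + 1) - x (k + 1) := rfl
    rw [h2]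
    nth_rewrite 2 [hrun.x_succ k hk]
    rw [← ha]
    module
  have hj := hrun.read_le k hk
  -- The residual is `a (x_j - x_{j-1})` for `j ≥ 1` and the conventional vector for `j = 0`, so
  -- both branches of `compensated` become one formula.
  have hw : w k = x (j k) + ((1 - a ^ (k - j k + 1)) / (1 - a)) • r (j k) := by
    rw [hrun.read k hk, compensated]
    split_ifs with h0
    · rw [h0]; rfl
    · obtain ⟨m, hm⟩ := Nat.exists_eq_succ_of_ne_zero h0
      have hmn : m < n := by omega
      have h1 : r m + θ • d m = x (m + 1) - x m := by rw [hx1 m hmn]; abel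
      rw [hm, Nat.succ_eq_add_one, Nat.add_sub_cancel, hr1 m hmn, h1, smul_smul]
      congr 2
      ring
  have hext := norm_extrapolation_error_le ha0 ha2 hθ0 hx1 hr1 (k - j k) (j k) (by omega)
  rw [Nat.add_sub_cancel' hj, ← hw] at hext
  have hsub : ∑ l ∈ Finset.Ico (j k) k, ‖d l‖ ≤ ∑ l ∈ Finset.Ico (k - τ) k, ‖d l‖ := by
    have := hrun.delay_le k hk
    exact Finset.sum_le_sum_of_subset_of_nonneg
      (Finset.Ico_subset_Ico (by omega) le_rfl) fun _ _ _ => norm_nonneg _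
  calc ‖x (k + 1) - w k‖ = ‖(x k + r k - w k) + θ • d k‖ := by rw [hx1 k hk]; congr 1; abel
    _ ≤ ‖x k + r k - w k‖ + θ * ‖d k‖ := by
        refine (norm_add_le _ _).trans_eq ?_
        rw [norm_smul, Real.norm_of_nonneg hθ0]
    _ ≤ 2 * θ * ∑ l ∈ Finset.Ico (k - τ) k, ‖d l‖ + θ * ‖d k‖ := by
        gcongr
        exact hext.trans (by gcongr)
    _ = _ := by ring

lemma norm_sub_read_sq_le (hrun : IsEpochRun f h θ γ τ y i j x z w) (hθ0 : 0 ≤ θ)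
    (hθ : θ ≤ 1 / 2) {k : ℕ} (hk : k < n) :
    ‖x (k + 1) - w k‖ ^ 2 ≤ θ ^ 2 * (2 * ‖z (k + 1) - z k‖ ^ 2
      + 8 * τ * ∑ l ∈ Finset.Ico (k - τ) k, ‖z (l + 1) - z l‖ ^ 2) := by
  have h1 := hrun.norm_sub_read_le hθ0 hθ hk
  set A := ‖z (k + 1) - z k‖
  set B := ∑ l ∈ Finset.Ico (k - τ) k, ‖z (l + 1) - z l‖ with hB
  have h2 : B ^ 2 ≤ τ * ∑ l ∈ Finset.Ico (k - τ) k, ‖z (l + 1) - z l‖ ^ 2 := by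
    refine sq_sum_le_card_mul_sum_sq.trans ?_
    gcongr
    rw [Nat.card_Ico]
    omega
  calc ‖x (k + 1) - w k‖ ^ 2 ≤ (θ * (A + 2 * B)) ^ 2 := by gcongr
    _ = θ ^ 2 * (A + 2 * B) ^ 2 := by ring
    _ ≤ θ ^ 2 * (2 * A ^ 2 + 8 * B ^ 2) := by
        gcongr
        nlinarith [sq_nonneg (A - 2 * B)]
    _ ≤ _ := mul_le_mul_of_nonneg_left (by linarith) (sq_nonneg θ)

lemma sum_norm_sub_read_sq_le (hrun : IsEpochRun f h θ γ τ y i j x z w) (hθ0 : 0 ≤ θ)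
    (hθ : θ ≤ 1 / 2) {ρ κ : ℝ} (hρ : 0 ≤ ρ) (hκ : ∀ m, m ≤ τ → m ≤ n → ρ ^ m ≤ κ) :
    ∑ k ∈ Finset.range n, ρ ^ k * ‖x (k + 1) - w k‖ ^ 2
      ≤ θ ^ 2 * (2 + 8 * κ * τ ^ 2)
        * ∑ k ∈ Finset.range n, ρ ^ k * ‖z (k + 1) - z k‖ ^ 2 := by
  have hd := weighted_delay_sum_le (q := fun k => ‖z (k + 1) - z k‖ ^ 2) hρ hκ
    (fun _ => sq_nonneg _)
  calc ∑ k ∈ Finset.range n, ρ ^ k * ‖x (k + 1) - w k‖ ^ 2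
      ≤ ∑ k ∈ Finset.range n, ρ ^ k * (θ ^ 2 * (2 * ‖z (k + 1) - z k‖ ^ 2
          + 8 * τ * ∑ l ∈ Finset.Ico (k - τ) k, ‖z (l + 1) - z l‖ ^ 2)) := by
        gcongr with k hk
        exact hrun.norm_sub_read_sq_le hθ0 hθ (Finset.mem_range.1 hk)
    _ = θ ^ 2 * (2 * (∑ k ∈ Finset.range n, ρ ^ k * ‖z (k + 1) - z k‖ ^ 2) + 8 * τ *
          ∑ k ∈ Finset.range n, ρ ^ k *
            ∑ l ∈ Finset.Ico (k - τ) k, ‖z (l + 1) - z l‖ ^ 2) := by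
        simp only [Finset.mul_sum, ← Finset.sum_add_distrib]
        refine Finset.sum_congr rfl fun k _ => ?_
        simp only [mul_add, Finset.mul_sum]
        congr 1
        · ring
        · exact Finset.sum_congr rfl fun l _ => by ring
    _ ≤ θ ^ 2 * (2 * (∑ k ∈ Finset.range n, ρ ^ k * ‖z (k + 1) - z k‖ ^ 2) + 8 * τ *
          (κ * τ * ∑ k ∈ Finset.range n, ρ ^ k * ‖z (k + 1) - z k‖ ^ 2)) := by
        gcongr
    _ = _ := by ring

variable [FiniteDimensional ℝ V]

/-- The one-step estimates of an epoch, summed with the weights `ρ ^ k`. -/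
lemma weighted_sum_le (hrun : IsEpochRun f h θ γ τ y i j x z w) (hn : 0 < n) {L μ ρ κ : ℝ}
    (hL : 0 < L) (hμ : 0 ≤ μ) (hγ : 0 < γ) (hθ0 : 0 < θ) (hθ : θ ≤ 1 / 2)
    (hf : ∀ i, ConvexSmooth L (f i)) (hh : StrongConvexOn Set.univ μ h)
    (hρ : ρ = 1 + μ * γ / θ) (hκ : ∀ m, m ≤ τ → m ≤ n → ρ ^ m ≤ κ)
    (hstep : γ * L * (4 + 8 * κ * τ ^ 2) ≤ 1) (u : V) :
    ∑ k ∈ Finset.range n, ρ ^ k * (objective f h (x (k + 1)) - objective f h u)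
        + θ ^ 2 / (2 * γ) * (ρ ^ n * ‖z n - u‖ ^ 2)
      ≤ (1 / 2 - θ) * ∑ k ∈ Finset.range n, ρ ^ k * (objective f h (x k) - objective f h u)
        + 1 / 2 * (∑ k ∈ Finset.range n, ρ ^ k) * (objective f h y - objective f h u)
        + θ ^ 2 / (2 * γ) * ‖z 0 - u‖ ^ 2
        + ∑ k ∈ Finset.range n, ρ ^ k * noise L θ f u (z k) y (w k) (i k) := by
  have hρ0 : 0 ≤ ρ := by rw [hρ]; positivity
  have hsum := hrun.sum_norm_sub_read_sq_le hθ0.le hθ hρ0 hκ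
  set D : V → ℝ := fun v => objective f h v - objective f h u with hD
  have hone : ∀ k ∈ Finset.range n, ρ ^ k * D (x (k + 1)) ≤ (1 / 2 - θ) * (ρ ^ k * D (x k))
      + 1 / 2 * (ρ ^ k * D y)
      - θ ^ 2 / (2 * γ) * (ρ ^ (k + 1) * ‖z (k + 1) - u‖ ^ 2 - ρ ^ k * ‖z k - u‖ ^ 2)
      + ρ ^ k * noise L θ f u (z k) y (w k) (i k)
      - θ ^ 2 * (1 / (2 * γ) - L) * (ρ ^ k * ‖z (k + 1) - z k‖ ^ 2)
      + L / 2 * (ρ ^ k * ‖x (k + 1) - w k‖ ^ 2) := by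
    intro k hk
    rw [Finset.mem_range] at hk
    have hz := hrun.z_succ k hk
    have hx := hrun.x_succ k hk
    have hδ : z (k + 1) - z k = argmin fun δ => h (z k + δ)
        + inner ℝ (reducedGradient f y (w k) (i k)) δ + θ / (2 * γ) * ‖δ‖ ^ 2 := by
      rw [hz, add_sub_cancel_left]
    have ha : (1 - theta2 - θ : ℝ) = 1 / 2 - θ := by rw [theta2]; ring
    rw [ha, theta2, ← add_sub_cancel (z k) (z (k + 1))] at hx
    have := one_step hn hL hμ hγ hθ0 (sub_nonneg.2 hθ) (by ring) hf hh u (x k) y (z k) (w k)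
      (z (k + 1) - z k) (x (k + 1)) (i k) hδ hx
    rw [← hρ, add_sub_cancel] at this
    have := mul_le_mul_of_nonneg_left this (pow_nonneg hρ0 k)
    simp only [hD]
    rw [pow_succ ρ k]
    linarith
  have htot := Finset.sum_le_sum hone
  have htel := Finset.sum_range_sub (fun k => ρ ^ k * ‖z k - u‖ ^ 2) n
  simp only [Finset.sum_add_distrib, Finset.sum_sub_distrib, ← Finset.mul_sum] at htot htel
  rw [htel, ← Finset.sum_mul, pow_zero, one_mul] at htot
  set Q := ∑ k ∈ Finset.range n, ρ ^ k * ‖z (k + 1) - z k‖ ^ 2 with hQ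
  have hQ0 : 0 ≤ Q := Finset.sum_nonneg fun k _ => by positivity
  -- Here the delay error is absorbed by the movement of `z`; `hstep` is exactly the required
  -- inequality between the coefficients.
  have habs : L / 2 * (θ ^ 2 * (2 + 8 * κ * τ ^ 2) * Q) ≤ θ ^ 2 * (1 / (2 * γ) - L) * Q := by
    have h1 : L / 2 * (2 + 8 * κ * τ ^ 2) ≤ 1 / (2 * γ) - L := by
      rw [le_sub_iff_add_le, le_div_iff₀ (by positivity)]
      linarith
    have := mul_le_mul_of_nonneg_right h1 (mul_nonneg (sq_nonneg θ) hQ0)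
    linarith
  have := mul_le_mul_of_nonneg_left hsum (by positivity : 0 ≤ L / 2)
  linarith

end IsEpochRun

end

/-! ### The metered program: call count and passage to the recursion. -/

section

variable {V : Type*} [NormedAddCommGroup V] [InnerProductSpace ℝ V] [CompleteSpace V] {n : ℕ}

lemma fullGradient_ifo_calls (f : Fin n → V → ℝ) (x : V) :
    (fullGradient (ifo f) x).calls = n := by
  simp [fullGradient, Metered.sum, Metered.bind, Metered.pure, ifo]

lemma innerLoop_ifo_calls (f : Fin n → V → ℝ) (h : V → ℝ) (θ γ : ℝ) (st : EpochState V) (g : V)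
    (i : ℕ → Fin n) (j : ℕ → ℕ) (k : ℕ) :
    (innerLoop (ifo f) h θ γ st g i j k).calls = 2 * k := by
  induction k with
  | zero => rfl
  | succ k ih =>
    rw [innerLoop]
    simp only [Metered.bind, Metered.pure, ih, ifo]
    ring

lemma aasvrg_ifo_calls (f : Fin n → V → ℝ) (h : V → ℝ) (avg : (ℕ → V) → V) (θ : ℕ → ℝ) (γ : ℝ)
    (i : ℕ → Fin n) (j : ℕ → ℕ) (s : ℕ) :
    (aasvrg (ifo f) h avg θ γ i j s).calls = 3 * n * s := by
  induction s with
  | zero => rfl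
  | succ s ih =>
    rw [aasvrg]
    simp only [Metered.bind, Metered.pure, ih, epoch, fullGradient_ifo_calls, innerLoop_ifo_calls]
    ring

/-- The state of an epoch started at `st` after `k` iterations. -/
def innerState (f : Fin n → V → ℝ) (h : V → ℝ) (θ γ : ℝ) (st : EpochState V)
    (i : ℕ → Fin n) (j : ℕ → ℕ) (k : ℕ) : InnerState V :=
  (innerLoop (ifo f) h θ γ st (meanGradient f st.snap) i j k).value

/-- The point at which iteration `k` evaluates the component gradient. -/
def readPoint (θ : ℝ) (st : EpochState V) (c : InnerState V) (k j : ℕ) : V :=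
  compensated (1 - theta2 - θ) (θ • st.z + theta2 • st.snap + (1 - theta2 - θ) • st.x - st.x)
    c.x k j

/-- One asynchronous iteration. -/
def innerStep (f : Fin n → V → ℝ) (h : V → ℝ) (θ γ : ℝ) (st : EpochState V) (k : ℕ)
    (c : InnerState V) (i : Fin n) (j : ℕ) : InnerState V :=
  let z' : V := c.z + argmin fun δ => h (c.z + δ)
    + inner ℝ (reducedGradient f st.snap (readPoint θ st c k j) i) δ + θ / (2 * γ) * ‖δ‖ ^ 2
  ⟨Function.update c.x (k + 1) (θ • z' + theta2 • st.snap + (1 - theta2 - θ) • c.x k), z'⟩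

lemma innerState_succ (f : Fin n → V → ℝ) (h : V → ℝ) (θ γ : ℝ) (st : EpochState V)
    (i : ℕ → Fin n) (j : ℕ → ℕ) (k : ℕ) : innerState f h θ γ st i j (k + 1) =
      innerStep f h θ γ st k (innerState f h θ γ st i j k) (i k) (j k) := rfl

lemma innerState_x_of_le (f : Fin n → V → ℝ) (h : V → ℝ) (θ γ : ℝ) (st : EpochState V)
    (i : ℕ → Fin n) (j : ℕ → ℕ) {m k : ℕ} (hmk : m ≤ k) :
    (innerState f h θ γ st i j k).x m = (innerState f h θ γ st i j m).x m := by
  induction k, hmk using Nat.le_induction with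
  | base => rfl
  | succ k hk ih =>
    rw [innerState_succ, innerStep]
    simp only
    rw [Function.update_of_ne (by omega), ih]

lemma compensated_congr {W : Type*} [NormedAddCommGroup W] [InnerProductSpace ℝ W] {a : ℝ}
    {p : W} {x x' : ℕ → W} {k j : ℕ} (hj : j ≤ k)
    (hx : ∀ m ≤ k, x m = x' m) : compensated a p x k j = compensated a p x' k j := by
  unfold compensated
  rw [hx 0 (by omega), hx j hj, hx (j - 1) (by omega)]

/-- A stored iterate is never overwritten, so the diagonal entries `x k` of the states after `k`
steps form the whole history that later reads see. -/
lemma isEpochRun_innerState (f : Fin n → V → ℝ) (h : V → ℝ) (θ γ : ℝ) (τ : ℕ)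
    (st : EpochState V) (i : ℕ → Fin n) (j : ℕ → ℕ) (hj : ∀ k < n, j k ≤ k)
    (hτ : ∀ k < n, k ≤ j k + τ) :
    IsEpochRun f h θ γ τ st.snap i j (fun k => (innerState f h θ γ st i j k).x k)
      (fun k => (innerState f h θ γ st i j k).z)
      (fun k => readPoint θ st (innerState f h θ γ st i j k) k (j k)) where
  z_succ k _ := rfl
  x_succ k _ := by
    rw [innerState_succ]
    simp only [innerStep]
    rw [Function.update_self]
  read k hk := compensated_congr (hj k hk) fun m hm => innerState_x_of_le f h θ γ st i j hm
  read_le := hj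
  delay_le := hτ

/-- The noise of iteration `k` as a function of the state, the sample and the read index. -/
def iterationNoise (L θ : ℝ) (f : Fin n → V → ℝ) (u : V) (st : EpochState V) (k : ℕ)
    (c : InnerState V) (j : ℕ) (i : Fin n) : ℝ :=
  noise L θ f u c.z st.snap (readPoint θ st c k j) i

end

/-! ### Finitely valued random variables and the mean over a fresh sample. -/

section FiniteValued

variable {Ω : Type*} {β β' : Type*}

/-- `g` takes finitely many values and its fibres are `m`-measurable; no measurable structure on
the codomain is involved. -/
def FiniteValued (m : MeasurableSpace Ω) (g : Ω → β) : Prop :=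
  (Set.range g).Finite ∧ ∀ b, MeasurableSet[m] (g ⁻¹' {b})

namespace FiniteValued

variable {m m' : MeasurableSpace Ω} {g : Ω → β}

lemma const (m : MeasurableSpace Ω) (b : β) : FiniteValued m fun _ : Ω => b := by
  refine ⟨(Set.finite_singleton b).subset (by rintro _ ⟨ω, rfl⟩; rfl), fun b' => ?_⟩
  by_cases h : b = b'
  · rw [Set.preimage_const_of_mem (by simpa using h)]; exact MeasurableSet.univ
  · rw [Set.preimage_const_of_notMem (by simpa using h)]; exact MeasurableSet.empty

lemma mono (hg : FiniteValued m g) (h : m ≤ m') : FiniteValued m' g :=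
  ⟨hg.1, fun b => h _ (hg.2 b)⟩

lemma measurableSet_preimage (hg : FiniteValued m g) (s : Set β) : MeasurableSet[m] (g ⁻¹' s) := by
  have : g ⁻¹' s = ⋃ b ∈ Set.range g ∩ s, g ⁻¹' {b} := by
    ext ω; simp
  rw [this]
  exact Set.Finite.measurableSet_biUnion (hg.1.subset Set.inter_subset_left) fun b _ => hg.2 b

lemma comp (hg : FiniteValued m g) (F : β → β') : FiniteValued m fun ω => F (g ω) := by
  refine ⟨?_, fun b => hg.measurableSet_preimage (F ⁻¹' {b})⟩
  have := hg.1.image F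
  rwa [← Set.range_comp] at this

lemma prodMk (hg : FiniteValued m g) {g' : Ω → β'} (hg' : FiniteValued m g') :
    FiniteValued m fun ω => (g ω, g' ω) := by
  refine ⟨(hg.1.prod hg'.1).subset ?_, fun b => ?_⟩
  · rintro _ ⟨ω, rfl⟩
    exact ⟨⟨ω, rfl⟩, ⟨ω, rfl⟩⟩
  · have : (fun ω => (g ω, g' ω)) ⁻¹' {b} = g ⁻¹' {b.1} ∩ g' ⁻¹' {b.2} := by
      ext ω; simp [Prod.ext_iff]
    rw [this]
    exact (hg.2 _).inter (hg'.2 _)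

lemma measurable [MeasurableSpace β] (hg : FiniteValued m g) : Measurable[m] g :=
  fun s _ => hg.measurableSet_preimage s

lemma integrable {mΩ : MeasurableSpace Ω} {P : Measure Ω} [IsFiniteMeasure P] {g : Ω → ℝ}
    (hg : FiniteValued mΩ g) : Integrable g P :=
  SimpleFunc.integrable_of_isFiniteMeasure (⟨g, hg.2, hg.1⟩ : SimpleFunc Ω ℝ)

end FiniteValued

lemma finiteValued_of_finite {m : MeasurableSpace Ω} [Finite β] [MeasurableSpace β]
    [MeasurableSingletonClass β] {g : Ω → β} (hg : Measurable[m] g) : FiniteValued m g :=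
  ⟨Set.toFinite _, fun b => hg (measurableSet_singleton b)⟩

/-- A function of a past variable and an independent uniform sample has nonpositive mean if its
sum over the samples is nonpositive. -/
lemma integral_uniform_sample_nonpos {n : ℕ} {m mΩ : MeasurableSpace Ω} {P : Measure Ω}
    [IsProbabilityMeasure P] (hm : m ≤ mΩ) {Y : Ω → β} (hY : FiniteValued m Y) {I : Ω → Fin n}
    (hI : Measurable I) (hunif : ∀ i, P (I ⁻¹' {i}) = (n : ENNReal)⁻¹)
    (hind : Indep m (MeasurableSpace.comap I ⊤) P) {ψ : β → Fin n → ℝ}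
    (hψ : ∀ b, ∑ i, ψ b i ≤ 0) : ∫ ω, ψ (Y ω) (I ω) ∂P ≤ 0 := by
  -- Splitting by the value of the sample turns each summand into a product of a past variable and
  -- an indicator, to which independence applies.
  have hdecomp : ∀ ω, ψ (Y ω) (I ω) = ∑ i, ψ (Y ω) i * (if I ω = i then 1 else 0) := by
    intro ω; simp
  have hI' : FiniteValued mΩ I := finiteValued_of_finite hI
  have hint : ∀ i, Integrable (fun ω => ψ (Y ω) i * (if I ω = i then 1 else 0)) P := fun i =>
    FiniteValued.integrable (((hY.mono hm).prodMk hI').comp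
      fun p => ψ p.1 i * (if p.2 = i then 1 else 0))
  have hprod : ∀ i, ∫ ω, ψ (Y ω) i * (if I ω = i then 1 else 0) ∂P
      = (n : ℝ)⁻¹ * ∫ ω, ψ (Y ω) i ∂P := by
    intro i
    have hYi : FiniteValued m fun ω => ψ (Y ω) i := hY.comp fun b => ψ b i
    have hif : IndepFun (fun ω => ψ (Y ω) i) (fun ω => if I ω = i then (1 : ℝ) else 0) P := by
      refine indep_of_indep_of_le_left (indep_of_indep_of_le_right hind ?_) ?_
      · rintro s ⟨t, -, rfl⟩
        exact ⟨(fun k => if k = i then (1 : ℝ) else 0) ⁻¹' t, trivial, rfl⟩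
      · rintro s ⟨t, ht, rfl⟩
        exact hYi.measurable ht
    have hIi : FiniteValued mΩ fun ω => if I ω = i then (1 : ℝ) else 0 :=
      hI'.comp fun k => if k = i then (1 : ℝ) else 0
    have h1 := hif.integral_mul_eq_mul_integral (hYi.mono hm).measurable.aestronglyMeasurable
      hIi.measurable.aestronglyMeasurable
    have h2 : ∫ ω, (if I ω = i then (1 : ℝ) else 0) ∂P = (n : ℝ)⁻¹ := by
      have : (fun ω => if I ω = i then (1 : ℝ) else 0) = (I ⁻¹' {i}).indicator 1 := by
        ext ω; by_cases hω : I ω = i <;> simp [hω]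
      rw [this, integral_indicator_one (hI (measurableSet_singleton i)), Measure.real, hunif i]
      simp
    refine h1.trans ?_
    rw [h2, mul_comm]
  simp_rw [hdecomp]
  rw [integral_finsetSum _ fun i _ => hint i]
  simp_rw [hprod]
  rw [← Finset.mul_sum, ← integral_finsetSum _ fun i _ =>
    ((hY.mono hm).comp fun b => ψ b i).integrable]
  exact mul_nonpos_of_nonneg_of_nonpos (by positivity) (integral_nonpos fun ω => hψ _)

end FiniteValued

/-! ### The random process and the mean of its noise. -/

section Sampling

variable {V : Type*} [NormedAddCommGroup V] [InnerProductSpace ℝ V] [CompleteSpace V] {n : ℕ}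
  {Ω : Type*} {mΩ : MeasurableSpace Ω} {P : Measure Ω}
  {τ : ℕ} {ℱ : Filtration ℕ mΩ} {I : ℕ → Ω → Fin n} {J : ℕ → Ω → ℕ}

lemma AsyncSampling.finiteValued_sample (hs : AsyncSampling P n τ ℱ I J) (t : ℕ) :
    FiniteValued (ℱ (t + 1)) (I t) :=
  finiteValued_of_finite (hs.sample_measurable t)

lemma AsyncSampling.finiteValued_read (hs : AsyncSampling P n τ ℱ I J) (s : ℕ) {k : ℕ}
    (hk : k < n) : FiniteValued (ℱ (s * n + k)) (J (s * n + k)) := by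
  refine ⟨(Set.finite_Iic k).subset ?_, fun b => hs.read_measurable _ (measurableSet_singleton b)⟩
  rintro _ ⟨ω, rfl⟩
  exact hs.read_le s k ω hk

/-- The state of the algorithm before epoch `s`. -/
def epochState (f : Fin n → V → ℝ) (h : V → ℝ) (avg : (ℕ → V) → V) (θ : ℕ → ℝ) (γ : ℝ)
    (I : ℕ → Ω → Fin n) (J : ℕ → Ω → ℕ) (s : ℕ) (ω : Ω) : EpochState V :=
  (aasvrg (ifo f) h avg θ γ (fun t => I t ω) (fun t => J t ω) s).value

/-- The state of the algorithm before iteration `k` of epoch `s`. -/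
def iterationState (f : Fin n → V → ℝ) (h : V → ℝ) (avg : (ℕ → V) → V) (θ : ℕ → ℝ) (γ : ℝ)
    (I : ℕ → Ω → Fin n) (J : ℕ → Ω → ℕ) (s k : ℕ) (ω : Ω) : InnerState V :=
  innerState f h (θ s) γ (epochState f h avg θ γ I J s ω) (fun k => I (s * n + k) ω)
    (fun k => J (s * n + k) ω) k

variable (f : Fin n → V → ℝ) (h : V → ℝ) (avg : (ℕ → V) → V) (θ : ℕ → ℝ) (γ : ℝ)

/-- Finitely many samples and read indices allow arbitrary functions of the past, so neither
`argmin` nor `avg` has to be measurable. -/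
lemma AsyncSampling.finiteValued_iterationState (hs : AsyncSampling P n τ ℱ I J) {s : ℕ}
    (hst : FiniteValued (ℱ (s * n)) (epochState f h avg θ γ I J s)) {k : ℕ} (hk : k ≤ n) :
    FiniteValued (ℱ (s * n + k)) (iterationState f h avg θ γ I J s k) := by
  induction k with
  | zero => exact hst.comp fun st => (⟨fun _ => st.x, st.z⟩ : InnerState V)
  | succ k ih =>
    have h1 := (ih (by omega)).mono (ℱ.mono (s * n + k).le_succ)
    have h2 := hst.mono (ℱ.mono (by omega : s * n ≤ s * n + (k + 1)))
    have h3 := (hs.finiteValued_read s (show k < n by omega)).mono (ℱ.mono (s * n + k).le_succ)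
    have h4 := hs.finiteValued_sample (s * n + k)
    exact ((h2.prodMk h1).prodMk (h4.prodMk h3)).comp
      fun p => innerStep f h (θ s) γ p.1.1 k p.1.2 p.2.1 p.2.2

lemma AsyncSampling.finiteValued_epochState (hs : AsyncSampling P n τ ℱ I J) (s : ℕ) :
    FiniteValued (ℱ (s * n)) (epochState f h avg θ γ I J s) := by
  induction s with
  | zero => exact FiniteValued.const _ _
  | succ s ih =>
    have h1 := hs.finiteValued_iterationState f h avg θ γ ih le_rfl
    rw [Nat.succ_mul]
    exact h1.comp fun c => (⟨c.x n, c.z, avg c.x⟩ : EpochState V)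

lemma AsyncSampling.integrable_epochState [IsFiniteMeasure P] (hs : AsyncSampling P n τ ℱ I J)
    (s : ℕ) (φ : EpochState V → ℝ) :
    Integrable (fun ω => φ (epochState f h avg θ γ I J s ω)) P :=
  (((hs.finiteValued_epochState f h avg θ γ s).mono (ℱ.le _)).comp φ).integrable

/-- The noise of iteration `k` of epoch `s`. -/
def processNoise (L : ℝ) (u : V) (I : ℕ → Ω → Fin n) (J : ℕ → Ω → ℕ) (s k : ℕ) (ω : Ω) : ℝ :=
  iterationNoise L (θ s) f u (epochState f h avg θ γ I J s ω) k
    (iterationState f h avg θ γ I J s k ω) (J (s * n + k) ω) (I (s * n + k) ω)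

lemma AsyncSampling.finiteValued_past (hs : AsyncSampling P n τ ℱ I J) (s : ℕ) {k : ℕ}
    (hk : k < n) : FiniteValued (ℱ (s * n + k)) fun ω => (epochState f h avg θ γ I J s ω,
      iterationState f h avg θ γ I J s k ω, J (s * n + k) ω) :=
  ((hs.finiteValued_epochState f h avg θ γ s).mono (ℱ.mono (by omega))).prodMk
    ((hs.finiteValued_iterationState f h avg θ γ (hs.finiteValued_epochState f h avg θ γ s)
      hk.le).prodMk (hs.finiteValued_read s hk))

lemma AsyncSampling.integrable_processNoise [IsFiniteMeasure P] (hs : AsyncSampling P n τ ℱ I J)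
    (L : ℝ) (u : V) (s : ℕ) {k : ℕ} (hk : k < n) :
    Integrable (processNoise f h avg θ γ L u I J s k) P :=
  ((((hs.finiteValued_past f h avg θ γ s hk).mono (ℱ.le _)).prodMk
    ((hs.finiteValued_sample (s * n + k)).mono (ℱ.le _))).comp
      fun p => iterationNoise L (θ s) f u p.1.1 k p.1.2.1 p.1.2.2 p.2).integrable

lemma AsyncSampling.integral_processNoise_nonpos [IsProbabilityMeasure P]
    (hs : AsyncSampling P n τ ℱ I J) (hn : 0 < n) {L : ℝ} (hL : 0 < L)
    (hf : ∀ i, ConvexSmooth L (f i)) (u : V) (s : ℕ) {k : ℕ} (hk : k < n) :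
    ∫ ω, processNoise f h avg θ γ L u I J s k ω ∂P ≤ 0 :=
  integral_uniform_sample_nonpos (ℱ.le (s * n + k)) (hs.finiteValued_past f h avg θ γ s hk)
    ((hs.sample_measurable (s * n + k)).mono (ℱ.le _) le_rfl) (hs.sample_uniform _)
    (hs.sample_indep _) (ψ := fun b i => iterationNoise L (θ s) f u b.1 k b.2.1 b.2.2 i)
    fun _ => sum_noise_nonpos hn hL hf _ _ _ _ _

/-- A pathwise potential inequality with noise holds without the noise in the mean. -/
lemma AsyncSampling.integral_potential_le [IsProbabilityMeasure P]
    (hs : AsyncSampling P n τ ℱ I J) (hn : 0 < n) {L : ℝ} (hL : 0 < L)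
    (hf : ∀ i, ConvexSmooth L (f i)) (u : V) (s : ℕ) {φ φ' : EpochState V → ℝ} {c : ℕ → ℝ}
    (hc : ∀ k, 0 ≤ c k)
    (hφ : ∀ ω, φ' (epochState f h avg θ γ I J (s + 1) ω) ≤ φ (epochState f h avg θ γ I J s ω)
      + ∑ k ∈ Finset.range n, c k * processNoise f h avg θ γ L u I J s k ω) :
    ∫ ω, φ' (epochState f h avg θ γ I J (s + 1) ω) ∂P
      ≤ ∫ ω, φ (epochState f h avg θ γ I J s ω) ∂P := by
  have hi : ∀ k ∈ Finset.range n,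
      Integrable (fun ω => c k * processNoise f h avg θ γ L u I J s k ω) P := fun k hk =>
    (hs.integrable_processNoise f h avg θ γ L u s (Finset.mem_range.1 hk)).const_mul _
  have h1 := integral_mono (hs.integrable_epochState f h avg θ γ (s + 1) φ')
    ((hs.integrable_epochState f h avg θ γ s φ).add (integrable_finsetSum _ hi)) hφ
  simp only [Pi.add_apply] at h1
  rw [integral_add (hs.integrable_epochState f h avg θ γ s φ) (integrable_finsetSum _ hi),
    integral_finsetSum _ hi] at h1
  have h2 : ∑ k ∈ Finset.range n, ∫ ω, c k * processNoise f h avg θ γ L u I J s k ω ∂P ≤ 0 :=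
    Finset.sum_nonpos fun k hk => by
      rw [integral_const_mul]
      exact mul_nonpos_of_nonneg_of_nonpos (hc k)
        (hs.integral_processNoise_nonpos f h avg θ γ hn hL hf u s (Finset.mem_range.1 hk))
  linarith

end Sampling

/-! ### Potentials and their change over one epoch. -/

section

variable {V : Type*} [NormedAddCommGroup V] [InnerProductSpace ℝ V] {n : ℕ}

lemma convexOn_mean {f : Fin n → V → ℝ} (hf : ∀ i, ConvexOn ℝ Set.univ (f i)) :
    ConvexOn ℝ Set.univ fun x => (n : ℝ)⁻¹ * ∑ i, f i x := by
  have h1 : ConvexOn ℝ Set.univ fun x => ∑ i, f i x := by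
    refine ⟨convex_univ, fun x _ y _ a b ha hb hab => ?_⟩
    rw [Finset.smul_sum, Finset.smul_sum, ← Finset.sum_add_distrib]
    exact Finset.sum_le_sum fun i _ => (hf i).2 trivial trivial ha hb hab
  exact h1.smul (inv_nonneg.2 (Nat.cast_nonneg n))

lemma strongConvexOn_objective {μ : ℝ} {f : Fin n → V → ℝ} (hf : ∀ i, ConvexOn ℝ Set.univ (f i))
    {h : V → ℝ} (hh : StrongConvexOn Set.univ μ h) :
    StrongConvexOn Set.univ μ (objective f h) := by
  have := UniformConvexOn.add hh (uniformConvexOn_zero.2 (convexOn_mean hf))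
  rw [add_zero] at this
  exact this

lemma convexOn_weighted_average_le {φ : V → ℝ} (hφ : ConvexOn ℝ Set.univ φ) {p : ℕ → ℝ}
    (hp : ∀ k, 0 ≤ p k) (hsum : 0 < ∑ k ∈ Finset.range n, p k) (x : ℕ → V) (b : ℝ) :
    (∑ k ∈ Finset.range n, p k) *
        (φ ((∑ k ∈ Finset.range n, p k)⁻¹ • ∑ k ∈ Finset.range n, p k • x k) - b)
      ≤ ∑ k ∈ Finset.range n, p k * (φ (x k) - b) := by
  have h1 := hφ.map_centerMass_le (t := Finset.range n) (w := p) (p := x) (fun k _ => hp k) hsum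
    (fun _ _ => trivial)
  rw [Finset.centerMass, Finset.centerMass] at h1
  have h2 := mul_le_mul_of_nonneg_left h1 hsum.le
  simp only [Function.comp_apply, smul_eq_mul] at h2
  rw [mul_inv_cancel_left₀ hsum.ne'] at h2
  simp only [mul_sub, Finset.sum_sub_distrib, ← Finset.sum_mul]
  linarith

variable [CompleteSpace V]
  {Ω : Type*} {mΩ : MeasurableSpace Ω} {P : Measure Ω}
  {τ : ℕ} {ℱ : Filtration ℕ mΩ} {I : ℕ → Ω → Fin n} {J : ℕ → Ω → ℕ}
  {f : Fin n → V → ℝ} {h : V → ℝ} {avg : (ℕ → V) → V} {θ : ℕ → ℝ} {γ : ℝ}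

/-- The iterate `x k` of epoch `s`. -/
def iterate (f : Fin n → V → ℝ) (h : V → ℝ) (avg : (ℕ → V) → V) (θ : ℕ → ℝ) (γ : ℝ)
    (I : ℕ → Ω → Fin n) (J : ℕ → Ω → ℕ) (s : ℕ) (ω : Ω) (k : ℕ) : V :=
  (iterationState f h avg θ γ I J s k ω).x k

lemma epochState_succ_snap (havg : ∀ x x' : ℕ → V, (∀ k ≤ n, x k = x' k) → avg x = avg x')
    (s : ℕ) (ω : Ω) : (epochState f h avg θ γ I J (s + 1) ω).snap =
      avg (iterate f h avg θ γ I J s ω) :=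
  havg _ _ fun _ hk => innerState_x_of_le _ _ _ _ _ _ _ hk

variable [FiniteDimensional ℝ V]

lemma AsyncSampling.weighted_sum_le (hs : AsyncSampling P n τ ℱ I J) (hn : 0 < n)
    {L μ ρ κ : ℝ} (hL : 0 < L) (hμ : 0 ≤ μ) (hγ : 0 < γ) (s : ℕ) (hθ0 : 0 < θ s)
    (hθ : θ s ≤ 1 / 2) (hf : ∀ i, ConvexSmooth L (f i)) (hh : StrongConvexOn Set.univ μ h)
    (hρ : ρ = 1 + μ * γ / θ s) (hκ : ∀ m, m ≤ τ → m ≤ n → ρ ^ m ≤ κ)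
    (hstep : γ * L * (4 + 8 * κ * τ ^ 2) ≤ 1) (u : V) (ω : Ω) :
    ∑ k ∈ Finset.range n,
          ρ ^ k * (objective f h (iterate f h avg θ γ I J s ω (k + 1)) - objective f h u)
        + θ s ^ 2 / (2 * γ) * (ρ ^ n * ‖(epochState f h avg θ γ I J (s + 1) ω).z - u‖ ^ 2)
      ≤ (1 / 2 - θ s) * ∑ k ∈ Finset.range n,
          ρ ^ k * (objective f h (iterate f h avg θ γ I J s ω k) - objective f h u)
        + 1 / 2 * (∑ k ∈ Finset.range n, ρ ^ k) *
          (objective f h (epochState f h avg θ γ I J s ω).snap - objective f h u)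
        + θ s ^ 2 / (2 * γ) * ‖(epochState f h avg θ γ I J s ω).z - u‖ ^ 2
        + ∑ k ∈ Finset.range n, ρ ^ k * processNoise f h avg θ γ L u I J s k ω :=
  (isEpochRun_innerState f h (θ s) γ τ (epochState f h avg θ γ I J s ω)
    (fun k => I (s * n + k) ω) (fun k => J (s * n + k) ω) (fun k hk => hs.read_le s k ω hk)
    (fun k hk => hs.delay_le s k ω hk)).weighted_sum_le hn hL hμ hγ hθ0 hθ hf hh hρ hκ hstep u

/-- The potential of the method without strong convexity, for `θ = 2 / t`. -/
def sublinearPotential (f : Fin n → V → ℝ) (h : V → ℝ) (γ : ℝ) (u : V) (t : ℝ)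
    (st : EpochState V) : ℝ :=
  t ^ 2 / 8 * (n * (objective f h st.snap - objective f h u))
    + (t ^ 2 / 8 - t / 2) * (objective f h st.x - objective f h u) + ‖st.z - u‖ ^ 2 / (2 * γ)

/-- The epoch estimate times `t² / 4 = 1 / θ²` makes the distance coefficient independent of `t`. It
leaves `t²/8 + t/2` on the sum of gaps, which exceeds `(t + 1)²/8`; the surplus pays for the growing
coefficient of the last gap. -/
lemma AsyncSampling.sublinearPotential_le (hs : AsyncSampling P n τ ℱ I J) (hn : 0 < n)
    {L : ℝ} (hL : 0 < L) (hγ : 0 < γ) (hf : ∀ i, ConvexSmooth L (f i))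
    (hh : ConvexOn ℝ Set.univ h) (hstep : γ * L * (4 + 8 * τ ^ 2) ≤ 1) {u : V}
    (hu : ∀ x, objective f h u ≤ objective f h x) (s : ℕ) (ω : Ω) :
    let X := epochState f h (uniformAverage n) (fun s => 2 / ((s : ℝ) + 4)) γ I J
    sublinearPotential f h γ u (((s + 1 : ℕ) : ℝ) + 4) (X (s + 1) ω) ≤
      sublinearPotential f h γ u ((s : ℝ) + 4) (X s ω) + ∑ k ∈ Finset.range n,
        ((s : ℝ) + 4) ^ 2 / 4 * processNoise f h (uniformAverage n)
          (fun s => 2 / ((s : ℝ) + 4)) γ L u I J s k ω := by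
  intro X
  have hθ : 2 / ((s : ℝ) + 4) ≤ 1 / 2 := by
    rw [div_le_div_iff₀ (by positivity) (by norm_num)]
    linarith [s.cast_nonneg (α := ℝ)]
  have hconv : ConvexOn ℝ Set.univ (objective f h) :=
    strongConvexOn_zero.1 (strongConvexOn_objective (fun i => (hf i).1) (strongConvexOn_zero.2 hh))
  have hsum := hs.weighted_sum_le (avg := uniformAverage n) (θ := fun s => 2 / ((s : ℝ) + 4))
    (ρ := 1) (κ := 1) hn hL le_rfl hγ s (by positivity) hθ hf (strongConvexOn_zero.2 hh)
    (by simp) (by simp) (by simpa using hstep) u ω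
  set x := iterate f h (uniformAverage n) (fun s => 2 / ((s : ℝ) + 4)) γ I J s ω with hx
  have hsnap : (X (s + 1) ω).snap = uniformAverage n x := by
    refine epochState_succ_snap (fun x x' hxx => ?_) s ω
    unfold uniformAverage
    rw [Finset.sum_congr rfl fun k hk => hxx (k + 1) (Finset.mem_range.1 hk)]
  have hX0 : (X s ω).x = x 0 := rfl
  have hXn : (X (s + 1) ω).x = x n := rfl
  set D : V → ℝ := fun v => objective f h v - objective f h u with hD
  have hD0 : ∀ v, 0 ≤ D v := fun v => sub_nonneg.2 (hu v)
  have havg : (n : ℝ) * D (uniformAverage n x) ≤ ∑ k ∈ Finset.range n, D (x (k + 1)) := by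
    have := convexOn_weighted_average_le (n := n) hconv (p := fun _ => 1)
      (fun _ => zero_le_one) (by simpa using hn) (fun k => x (k + 1)) (objective f h u)
    simpa only [uniformAverage, one_mul, one_smul, Finset.sum_const, Finset.card_range,
      nsmul_eq_mul, mul_one] using this
  simp only [one_pow, one_mul, Finset.sum_const, Finset.card_range, nsmul_eq_mul, mul_one] at hsum
  have hshift : ∑ k ∈ Finset.range n, D (x k)
      = ∑ k ∈ Finset.range n, D (x (k + 1)) + D (x 0) - D (x n) := by
    have h1 := Finset.sum_range_succ (fun k => D (x k)) n
    have h2 := Finset.sum_range_succ' (fun k => D (x k)) n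
    linarith
  -- The last gap is one term of a nonnegative sum.
  have hlast : D (x n) ≤ ∑ k ∈ Finset.range n, D (x (k + 1)) := by
    have := Finset.single_le_sum (f := fun k => D (x (k + 1))) (fun k _ => hD0 _)
      (Finset.mem_range.2 (show n - 1 < n by omega))
    simp only [Nat.sub_add_cancel (show 1 ≤ n from hn)] at this
    exact this
  change ∑ k ∈ Finset.range n, D (x (k + 1)) + _ * ‖(X (s + 1) ω).z - u‖ ^ 2
    ≤ _ * ∑ k ∈ Finset.range n, D (x k) + 1 / 2 * n * D (X s ω).snap
      + _ * ‖(X s ω).z - u‖ ^ 2 + _ at hsum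
  rw [hshift] at hsum
  set t : ℝ := (s : ℝ) + 4 with ht
  have ht4 : 4 ≤ t := by rw [ht]; linarith [s.cast_nonneg (α := ℝ)]
  have ht1 : ((s + 1 : ℕ) : ℝ) + 4 = t + 1 := by push_cast; rw [ht]; ring
  rw [ht1, ← Finset.mul_sum]
  unfold sublinearPotential
  rw [hsnap, hX0, hXn]
  change (t + 1) ^ 2 / 8 * (n * D _) + _ * D _ + _ ≤ _ * (n * D _) + _ * D _ + _ + _
  set T := ∑ k ∈ Finset.range n, D (x (k + 1)) with hT
  set N := ∑ k ∈ Finset.range n, processNoise f h (uniformAverage n)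
    (fun s => 2 / ((s : ℝ) + 4)) γ L u I J s k ω with hN
  have e1 : ∀ Z : ℝ, t ^ 2 / 4 * ((2 / t) ^ 2 / (2 * γ) * Z) = Z / (2 * γ) := fun Z => by
    field_simp; ring
  have e2 : ∀ Q : ℝ, t ^ 2 / 4 * (2 / t * Q) = t / 2 * Q := fun Q => by field_simp; ring
  have hmul' : (t ^ 2 / 8 + t / 2) * T + (t ^ 2 / 8 - t / 2) * D (x n)
      + ‖(X (s + 1) ω).z - u‖ ^ 2 / (2 * γ) ≤ (t ^ 2 / 8 - t / 2) * D (x 0)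
      + t ^ 2 / 8 * (n * D (X s ω).snap) + ‖(X s ω).z - u‖ ^ 2 / (2 * γ) + t ^ 2 / 4 * N := by
    have h1 := e1 (‖(X (s + 1) ω).z - u‖ ^ 2)
    have h2 := e1 (‖(X s ω).z - u‖ ^ 2)
    have h3 := e2 (T + D (x 0) - D (x n))
    -- With `θ` an opaque atom, the remaining inequality is linear in the products that occur.
    generalize 2 / t = q at hsum h1 h2 h3
    have := mul_le_mul_of_nonneg_left hsum (by positivity : 0 ≤ t ^ 2 / 4)
    linarith
  have h1 := mul_le_mul_of_nonneg_left havg (by positivity : 0 ≤ (t + 1) ^ 2 / 8)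
  have h2 := mul_le_mul_of_nonneg_left hlast (by linarith : 0 ≤ t / 4 - 3 / 8)
  have h3 : 0 ≤ T := (hD0 _).trans hlast
  nlinarith

/-- The potential of the strongly convex method. -/
def linearPotential (f : Fin n → V → ℝ) (h : V → ℝ) (θ γ ρ : ℝ) (u : V)
    (st : EpochState V) : ℝ :=
  (∑ k ∈ Finset.range n, ρ ^ k) / 2 * (objective f h st.snap - objective f h u)
    + (objective f h st.x - objective f h u) / ρ + θ ^ 2 / (2 * γ) * ‖st.z - u‖ ^ 2

/-- The new snapshot averages `x 0, …, x (n-1)`, so the sum over `x (k+1)` is shifted back at the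
price of `1 / ρ`. Its surplus `1/ρ - 1/2 + θ` over the old sum pays for the snapshot (`hβ2`), while
`ρ ^ n` contracts the other two terms (`hβ1`). -/
lemma AsyncSampling.linearPotential_le (hs : AsyncSampling P n τ ℱ I J) (hn : 0 < n)
    {L μ ρ κ β θ : ℝ} (hL : 0 < L) (hμ : 0 ≤ μ) (hγ : 0 < γ) (hθ0 : 0 < θ) (hθ : θ ≤ 1 / 2)
    (hf : ∀ i, ConvexSmooth L (f i)) (hh : StrongConvexOn Set.univ μ h)
    (hρ : ρ = 1 + μ * γ / θ) (hκ : ∀ m, m ≤ τ → m ≤ n → ρ ^ m ≤ κ)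
    (hstep : γ * L * (4 + 8 * κ * τ ^ 2) ≤ 1) (hβ1 : 1 + β ≤ ρ ^ n)
    (hβ2 : (1 + β) / 2 ≤ 1 / ρ - 1 / 2 + θ) (hβ0 : 0 ≤ β) {u : V}
    (hu : ∀ x, objective f h u ≤ objective f h x) (s : ℕ) (ω : Ω) :
    let X := epochState f h (geometricAverage ρ n) (fun _ => θ) γ I J
    (1 + β) * linearPotential f h θ γ ρ u (X (s + 1) ω) ≤
      linearPotential f h θ γ ρ u (X s ω) + ∑ k ∈ Finset.range n,
        ρ ^ k * processNoise f h (geometricAverage ρ n) (fun _ => θ) γ L u I J s k ω := by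
  intro X
  have hρ1 : 0 < ρ := by rw [hρ]; positivity
  have hconv : ConvexOn ℝ Set.univ (objective f h) :=
    strongConvexOn_zero.1 ((strongConvexOn_objective (fun i => (hf i).1) hh).mono hμ)
  have hsum := hs.weighted_sum_le (avg := geometricAverage ρ n) (θ := fun _ => θ)
    hn hL hμ hγ s hθ0 hθ hf hh hρ hκ hstep u ω
  set x := iterate f h (geometricAverage ρ n) (fun _ => θ) γ I J s ω with hx
  have hsnap : (X (s + 1) ω).snap = geometricAverage ρ n x := by
    refine epochState_succ_snap (fun x x' hxx => ?_) s ω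
    unfold geometricAverage
    congr 1
    exact Finset.sum_congr rfl fun k hk => by rw [hxx k (Finset.mem_range.1 hk).le]
  have hX0 : (X s ω).x = x 0 := rfl
  have hXn : (X (s + 1) ω).x = x n := rfl
  set D : V → ℝ := fun v => objective f h v - objective f h u with hD
  have hD0 : ∀ v, 0 ≤ D v := fun v => sub_nonneg.2 (hu v)
  have hΛ : 0 < ∑ k ∈ Finset.range n, ρ ^ k :=
    Finset.sum_pos (fun k _ => by positivity) ⟨0, Finset.mem_range.2 hn⟩
  have havg := convexOn_weighted_average_le (n := n) hconv (p := fun k => ρ ^ k)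
    (fun k => by positivity) hΛ x (objective f h u)
  change (∑ k ∈ Finset.range n, ρ ^ k) * D (geometricAverage ρ n x)
    ≤ ∑ k ∈ Finset.range n, ρ ^ k * D (x k) at havg
  have hshift : ∑ k ∈ Finset.range n, ρ ^ k * D (x (k + 1))
      = (∑ k ∈ Finset.range n, ρ ^ k * D (x k) + ρ ^ n * D (x n) - D (x 0)) / ρ := by
    have h1 := Finset.sum_range_succ (fun k => ρ ^ k * D (x k)) n
    have h2 := Finset.sum_range_succ' (fun k => ρ ^ k * D (x k)) n
    have h3 : ∑ k ∈ Finset.range n, ρ ^ (k + 1) * D (x (k + 1))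
        = ρ * ∑ k ∈ Finset.range n, ρ ^ k * D (x (k + 1)) := by
      rw [Finset.mul_sum]
      exact Finset.sum_congr rfl fun k _ => by ring
    rw [eq_div_iff hρ1.ne']
    rw [h3] at h2
    simp only [pow_zero, one_mul] at h2
    linarith
  change ∑ k ∈ Finset.range n, ρ ^ k * D (x (k + 1)) + _ * (_ * ‖(X (s + 1) ω).z - u‖ ^ 2)
    ≤ _ * ∑ k ∈ Finset.range n, ρ ^ k * D (x k) + 1 / 2 * _ * D (X s ω).snap
      + _ * ‖(X s ω).z - u‖ ^ 2 + _ at hsum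
  rw [hshift] at hsum
  unfold linearPotential
  rw [hsnap, hX0, hXn]
  change (1 + β) * (_ * D _ + D _ / ρ + _) ≤ _ * D _ + D _ / ρ + _ + _
  set Λ := ∑ k ∈ Finset.range n, ρ ^ k
  set A := ∑ k ∈ Finset.range n, ρ ^ k * D (x k) with hA
  have hA0 : 0 ≤ A := Finset.sum_nonneg fun k _ => mul_nonneg (by positivity) (hD0 _)
  have h1 : (1 + β) / 2 * (Λ * D (geometricAverage ρ n x)) ≤ (1 / ρ - 1 / 2 + θ) * A :=
    (mul_le_mul_of_nonneg_left havg (by positivity)).trans (mul_le_mul_of_nonneg_right hβ2 hA0)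
  have h2 := mul_le_mul_of_nonneg_right hβ1 (div_nonneg (hD0 (x n)) hρ1.le)
  have h3 := mul_le_mul_of_nonneg_right hβ1
    (by positivity : 0 ≤ θ ^ 2 / (2 * γ) * ‖(X (s + 1) ω).z - u‖ ^ 2)
  have e : (A + ρ ^ n * D (x n) - D (x 0)) / ρ
      = 1 / ρ * A + ρ ^ n * (D (x n) / ρ) - D (x 0) / ρ := by ring
  rw [e] at hsum
  linarith

end

/-! ### Convergence rates in expectation. -/

section

variable {V : Type*} [NormedAddCommGroup V] [InnerProductSpace ℝ V] [CompleteSpace V]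
  {n : ℕ} {τ : ℕ} {f : Fin n → V → ℝ} {h : V → ℝ} {γ : ℝ}

lemma reachesWithin_of_rate.{u} {avg : (ℕ → V) → V} {θ : ℕ → ℝ} {Fmin ε B : ℝ} {S : ℕ}
    (hB : 3 * (n : ℝ) * ((S : ℝ) + 1) ≤ B)
    (hrate : ∀ (Ω : Type u) (mΩ : MeasurableSpace Ω) (P : Measure Ω) (_ : IsProbabilityMeasure P)
      (ℱ : Filtration ℕ mΩ) (I : ℕ → Ω → Fin n) (J : ℕ → Ω → ℕ), AsyncSampling P n τ ℱ I J →
      (∫ ω, objective f h (epochState f h avg θ γ I J (S + 1) ω).snap ∂P) - Fmin ≤ ε) :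
    ReachesWithin.{u} f h avg θ γ τ Fmin ε B S := by
  intro Ω mΩ P hP ℱ I J hs out
  refine ⟨fun ω => ?_, ?_, hrate Ω mΩ P hP ℱ I J hs⟩
  · have : (out ω).calls = 3 * n * (S + 1) := aasvrg_ifo_calls _ _ _ _ _ _ _ _
    rw [this]
    push_cast
    exact hB
  · exact hs.integrable_epochState f h avg θ γ (S + 1) fun st => objective f h st.snap

variable [FiniteDimensional ℝ V]

section Rates

variable {Ω : Type*} {mΩ : MeasurableSpace Ω} {P : Measure Ω} [IsProbabilityMeasure P]
  {ℱ : Filtration ℕ mΩ} {I : ℕ → Ω → Fin n} {J : ℕ → Ω → ℕ}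

lemma AsyncSampling.sublinear_rate (hs : AsyncSampling P n τ ℱ I J) (hn : 0 < n)
    {L : ℝ} (hL : 0 < L) (hγ : 0 < γ) (hf : ∀ i, ConvexSmooth L (f i))
    (hh : ConvexOn ℝ Set.univ h) (hstep : γ * L * (4 + 8 * τ ^ 2) ≤ 1) {u : V}
    (hu : ∀ x, objective f h u ≤ objective f h x) (s : ℕ) :
    ((s : ℝ) + 4) ^ 2 / 8 * (n * (∫ ω, objective f h (epochState f h (uniformAverage n)
        (fun s => 2 / ((s : ℝ) + 4)) γ I J s ω).snap ∂P - objective f h u))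
      ≤ 2 * n * (objective f h 0 - objective f h u) + ‖u‖ ^ 2 / (2 * γ) := by
  set X := epochState f h (uniformAverage n) (fun s => 2 / ((s : ℝ) + 4)) γ I J with hX
  have hpot : ∀ s : ℕ, ∫ ω, sublinearPotential f h γ u ((s : ℝ) + 4) (X s ω) ∂P
      ≤ 2 * n * (objective f h 0 - objective f h u) + ‖u‖ ^ 2 / (2 * γ) := by
    intro s
    induction s with
    | zero =>
      -- At `t = 4` the coefficient `t²/8 - t/2` of the iterate vanishes.
      have : ∀ ω, sublinearPotential f h γ u (((0 : ℕ) : ℝ) + 4) (X 0 ω)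
          = 2 * n * (objective f h 0 - objective f h u) + ‖u‖ ^ 2 / (2 * γ) := by
        intro ω
        have h0 : X 0 ω = ⟨0, 0, 0⟩ := rfl
        rw [h0, sublinearPotential]
        simp only [zero_sub, norm_neg, CharP.cast_eq_zero, zero_add]
        ring
      simp_rw [this]
      simp
    | succ s ih =>
      refine le_trans ?_ ih
      exact hs.integral_potential_le f h _ _ γ hn hL hf u s
        (φ' := sublinearPotential f h γ u (((s + 1 : ℕ) : ℝ) + 4))
        (φ := sublinearPotential f h γ u ((s : ℝ) + 4)) (c := fun _ => ((s : ℝ) + 4) ^ 2 / 4)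
        (fun _ => by positivity) (hs.sublinearPotential_le hn hL hγ hf hh hstep hu s)
  refine le_trans ?_ (hpot s)
  have hint : Integrable (fun ω => objective f h (X s ω).snap) P :=
    hs.integrable_epochState f h _ _ γ s fun st => objective f h st.snap
  have e : ((s : ℝ) + 4) ^ 2 / 8 * (n * (∫ ω, objective f h (X s ω).snap ∂P - objective f h u))
      = ∫ ω, ((s : ℝ) + 4) ^ 2 / 8 * (n * (objective f h (X s ω).snap - objective f h u)) ∂P := by
    rw [integral_const_mul, integral_const_mul, integral_sub hint (integrable_const _)]
    simp
  rw [e]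
  refine integral_mono (((hint.sub (integrable_const _)).const_mul _).const_mul _)
    (hs.integrable_epochState f h _ _ γ s _) fun ω => ?_
  have h1 : 0 ≤ (((s : ℝ) + 4) ^ 2 / 8 - ((s : ℝ) + 4) / 2)
      * (objective f h (X s ω).x - objective f h u) := by
    refine mul_nonneg ?_ (sub_nonneg.2 (hu _))
    nlinarith [s.cast_nonneg (α := ℝ)]
  have h2 : 0 ≤ ‖(X s ω).z - u‖ ^ 2 / (2 * γ) := by positivity
  simp only [sublinearPotential]
  linarith

lemma AsyncSampling.linear_rate (hs : AsyncSampling P n τ ℱ I J) (hn : 0 < n)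
    {L μ ρ κ β θ : ℝ} (hL : 0 < L) (hμ : 0 ≤ μ) (hγ : 0 < γ) (hθ0 : 0 < θ) (hθ : θ ≤ 1 / 2)
    (hf : ∀ i, ConvexSmooth L (f i)) (hh : StrongConvexOn Set.univ μ h)
    (hρ : ρ = 1 + μ * γ / θ) (hκ : ∀ m, m ≤ τ → m ≤ n → ρ ^ m ≤ κ)
    (hstep : γ * L * (4 + 8 * κ * τ ^ 2) ≤ 1) (hβ1 : 1 + β ≤ ρ ^ n)
    (hβ2 : (1 + β) / 2 ≤ 1 / ρ - 1 / 2 + θ) (hβ0 : 0 ≤ β) {u : V}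
    (hu : ∀ x, objective f h u ≤ objective f h x) (s : ℕ) :
    (1 + β) ^ s * ((∑ k ∈ Finset.range n, ρ ^ k) / 2 *
        (∫ ω, objective f h (epochState f h (geometricAverage ρ n)
          (fun _ => θ) γ I J s ω).snap ∂P - objective f h u))
      ≤ ((∑ k ∈ Finset.range n, ρ ^ k) / 2 + 1 / ρ) * (objective f h 0 - objective f h u)
        + θ ^ 2 / (2 * γ) * ‖u‖ ^ 2 := by
  set X := epochState f h (geometricAverage ρ n) (fun _ => θ) γ I J with hX
  have hρ0 : 0 < ρ := by rw [hρ]; positivity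
  set Λ := ∑ k ∈ Finset.range n, ρ ^ k with hΛ
  have hpot : ∀ s : ℕ, (1 + β) ^ s * ∫ ω, linearPotential f h θ γ ρ u (X s ω) ∂P
      ≤ (Λ / 2 + 1 / ρ) * (objective f h 0 - objective f h u) + θ ^ 2 / (2 * γ) * ‖u‖ ^ 2 := by
    intro s
    induction s with
    | zero =>
      have : ∀ ω, linearPotential f h θ γ ρ u (X 0 ω)
          = (Λ / 2 + 1 / ρ) * (objective f h 0 - objective f h u)
            + θ ^ 2 / (2 * γ) * ‖u‖ ^ 2 := by
        intro ω
        have h0 : X 0 ω = ⟨0, 0, 0⟩ := rfl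
        rw [h0, linearPotential]
        simp only [zero_sub, norm_neg]
        ring
      simp_rw [this]
      simp
    | succ s ih =>
      refine le_trans ?_ ih
      have := hs.integral_potential_le f h _ _ γ hn hL hf u s
        (φ' := fun st => (1 + β) * linearPotential f h θ γ ρ u st)
        (φ := linearPotential f h θ γ ρ u) (c := fun k => ρ ^ k) (fun k => by positivity)
        (hs.linearPotential_le hn hL hμ hγ hθ0 hθ hf hh hρ hκ hstep hβ1 hβ2 hβ0 hu s)
      rw [integral_const_mul] at this
      rw [pow_succ, mul_assoc]
      exact mul_le_mul_of_nonneg_left this (by positivity)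
  refine le_trans ?_ (hpot s)
  refine mul_le_mul_of_nonneg_left ?_ (by positivity)
  have hint : Integrable (fun ω => objective f h (X s ω).snap) P :=
    hs.integrable_epochState f h _ _ γ s fun st => objective f h st.snap
  have e : Λ / 2 * (∫ ω, objective f h (X s ω).snap ∂P - objective f h u)
      = ∫ ω, Λ / 2 * (objective f h (X s ω).snap - objective f h u) ∂P := by
    rw [integral_const_mul, integral_sub hint (integrable_const _)]
    simp
  rw [e]
  refine integral_mono ((hint.sub (integrable_const _)).const_mul _)
    (hs.integrable_epochState f h _ _ γ s _) fun ω => ?_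
  have h1 : 0 ≤ (objective f h (X s ω).x - objective f h u) / ρ :=
    div_nonneg (sub_nonneg.2 (hu _)) hρ0.le
  have h2 : 0 ≤ θ ^ 2 / (2 * γ) * ‖(X s ω).z - u‖ ^ 2 := by positivity
  simp only [linearPotential]
  linarith

end Rates

end

section

/-! ### Arithmetic of the parameters and of the number of epochs. -/

section Arithmetic

lemma sublinear_calls_le {n τ b q : ℝ} (hn : 1 ≤ n) (hτ : 0 ≤ τ) (hb : 0 ≤ b) (hq : 0 ≤ q) :
    3 * n * (q * (4 + b * (1 + 2 * τ) / √n) + 2) ≤ (12 + 6 * b) * (n + (n + τ * √n) * q) := by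
  obtain ⟨r, hr⟩ : ∃ r, r = √n := ⟨_, rfl⟩
  have hr1 : 1 ≤ r := hr ▸ Real.one_le_sqrt.2 hn
  have hr2 : r ^ 2 = n := hr ▸ Real.sq_sqrt (by linarith)
  rw [← hr]
  have h3 : n * (b * (1 + 2 * τ) / r) = b * (r + 2 * τ * r) := by
    rw [← hr2]; field_simp
  have h4 : 3 * n * (q * (4 + b * (1 + 2 * τ) / r) + 2)
      = 6 * n + q * (12 * n + 3 * (b * (r + 2 * τ * r))) := by
    rw [← h3]; ring
  have h5 : b * r ≤ b * n := mul_le_mul_of_nonneg_left (by nlinarith) hb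
  have hτr : 0 ≤ τ * r := by positivity
  have hbn : 0 ≤ b * n := by positivity
  have h7 : 12 * n + 3 * (b * (r + 2 * τ * r)) ≤ (12 + 6 * b) * (n + τ * r) := by
    linarith
  have h8 := mul_le_mul_of_nonneg_left h7 hq
  rw [h4]
  linarith

lemma sublinear_weight_le {n τ b : ℝ} (hn : 1 ≤ n) (hτ : 0 ≤ τ) (hb : 0 ≤ b) :
    16 * n + b ^ 2 * (1 + 2 * τ ^ 2) ≤ n * (4 + b * (1 + 2 * τ) / √n) ^ 2 := by
  obtain ⟨r, hr⟩ : ∃ r, r = √n := ⟨_, rfl⟩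
  have hr1 : 1 ≤ r := hr ▸ Real.one_le_sqrt.2 hn
  have hr2 : r ^ 2 = n := hr ▸ Real.sq_sqrt (by linarith)
  rw [← hr]
  have e : n * (4 + b * (1 + 2 * τ) / r) ^ 2
      = 16 * n + 8 * (r * (b * (1 + 2 * τ))) + b ^ 2 * (1 + 2 * τ) ^ 2 := by
    rw [← hr2]; field_simp; ring
  rw [e]
  have h4 : 0 ≤ r * (b * (1 + 2 * τ)) := by positivity
  have h5 : b ^ 2 * (1 + 2 * τ ^ 2) ≤ b ^ 2 * (1 + 2 * τ) ^ 2 :=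
    mul_le_mul_of_nonneg_left (by nlinarith) (sq_nonneg b)
  linarith

/-- The lower step-size bound gives `1/γ ≤ 5L(1 + 2τ²)/c`. With `b² = 20/c` the right side of the
rate becomes `LR (16n + b²(1 + 2τ²)) / 8`, and `K` is chosen so that `nK²` dominates the bracket. -/
lemma sublinear_accuracy {n τ b c L R γ ε K T E D Z : ℝ} (hn : 0 < n) (hc : 0 < c) (hL : 0 < L)
    (hγ : 0 < γ) (hε : 0 < ε) (hR : 0 ≤ R) (hb : b ^ 2 = 20 / c) (hK : 0 ≤ K)
    (hstep : c ≤ 5 * γ * L + 10 * γ * L * τ ^ 2) (hD : D ≤ L * R) (hZ : Z ≤ R)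
    (hweight : 16 * n + b ^ 2 * (1 + 2 * τ ^ 2) ≤ n * K ^ 2) (hT : √(L * R / ε) * K ≤ T)
    (hT0 : 0 < T) (hrate : T ^ 2 / 8 * (n * E) ≤ 2 * n * D + Z / (2 * γ)) : E ≤ ε := by
  obtain ⟨q, hq⟩ : ∃ q, q = √(L * R / ε) := ⟨_, rfl⟩
  have hq0 : 0 ≤ q := hq ▸ Real.sqrt_nonneg _
  have hq2 : q ^ 2 = L * R / ε := hq ▸ Real.sq_sqrt (by positivity)
  rw [← hq] at hT
  have hγ' : 1 / γ ≤ 5 * L * (1 + 2 * τ ^ 2) / c := by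
    rw [div_le_div_iff₀ hγ hc]
    linarith
  have h1 : Z / (2 * γ) ≤ R * (5 * L * (1 + 2 * τ ^ 2) / c) / 2 := by
    have : Z / (2 * γ) = Z * (1 / γ) / 2 := by field_simp
    rw [this]
    have h1γ : 0 ≤ 1 / γ := by positivity
    have := (mul_le_mul_of_nonneg_right hZ h1γ).trans (mul_le_mul_of_nonneg_left hγ' hR)
    linarith
  have h2 : R * (5 * L * (1 + 2 * τ ^ 2) / c) / 2 = L * R * (b ^ 2 * (1 + 2 * τ ^ 2)) / 8 := by
    rw [hb]; field_simp; ring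
  have h3 := mul_le_mul_of_nonneg_left hD (by positivity : (0 : ℝ) ≤ 2 * n)
  have h4 : L * R = ε * q ^ 2 := by rw [hq2]; field_simp
  have h5 : L * R * (16 * n + b ^ 2 * (1 + 2 * τ ^ 2)) ≤ ε * n * T ^ 2 := by
    calc L * R * (16 * n + b ^ 2 * (1 + 2 * τ ^ 2)) ≤ L * R * (n * K ^ 2) := by gcongr
      _ = ε * n * (q * K) ^ 2 := by rw [h4]; ring
      _ ≤ ε * n * T ^ 2 := by gcongr
  have h6 : n * T ^ 2 * E ≤ n * T ^ 2 * ε := by linarith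
  exact le_of_mul_le_mul_left h6 (by positivity)

/-- The growth of the weights `ρ = 1 + σθ/n` over `n` iterations. -/
lemma weight_growth {n : ℕ} {σ θ ρ β : ℝ} (hn : 0 < n) (hσ0 : 0 < σ) (hσ1 : σ ≤ 8 / 95)
    (hθ0 : 0 < θ) (hθ : θ ≤ 1 / 2) (hρ : ρ = 1 + σ * θ / n) (hβ : β ≤ σ * θ) :
    (∀ m : ℕ, m ≤ n → ρ ^ m ≤ 95 / 64) ∧ 1 + β ≤ ρ ^ n ∧
      (1 + β) / 2 ≤ 1 / ρ - 1 / 2 + θ := by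
  have hn' : (1 : ℝ) ≤ n := by exact_mod_cast hn
  have hn0 : (0 : ℝ) < n := by linarith
  have hinc0 : 0 ≤ σ * θ / n := by positivity
  have hρ1 : 1 ≤ ρ := by linarith
  have hσθ : σ * θ ≤ 8 / 95 * θ := mul_le_mul_of_nonneg_right hσ1 hθ0.le
  refine ⟨fun m hm => ?_, ?_, ?_⟩
  · have h1 : ρ ^ m ≤ Real.exp (4 / 95) := by
      calc ρ ^ m ≤ ρ ^ n := pow_le_pow_right₀ hρ1 hm
        _ ≤ Real.exp (σ * θ / n) ^ n := by
            gcongr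
            rw [hρ, add_comm]
            exact Real.add_one_le_exp _
        _ = Real.exp (σ * θ) := by
            rw [← Real.exp_nat_mul, mul_div_cancel₀ _ hn0.ne']
        _ ≤ Real.exp (4 / 95) := Real.exp_le_exp.2 (by linarith)
    -- Yields `exp (4/95) ≤ 95/91`, well below `95/64`.
    have h2 := Real.one_sub_le_exp_neg (4 / 95)
    have h3 : Real.exp (4 / 95) * Real.exp (-(4 / 95)) = 1 := by rw [← Real.exp_add]; simp
    have h4 := mul_le_mul_of_nonneg_left h2 (Real.exp_pos (4 / 95)).le
    linarith
  · have h1 := one_add_mul_le_pow (show (-2 : ℝ) ≤ σ * θ / n by linarith) n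
    rw [mul_div_cancel₀ _ hn0.ne', ← hρ] at h1
    linarith
  · have h1 : 1 - σ * θ ≤ 1 / ρ := by
      rw [le_div_iff₀ (by linarith)]
      have h2 : σ * θ / n ≤ σ * θ := div_le_self (by positivity) hn'
      have h3 : 0 ≤ σ * θ * (σ * θ / n) := by positivity
      rw [hρ]
      linarith
    linarith

/-- For `β ≤ 1` one has `log (1 + β) ≥ β / (1 + β) ≥ β / 2`. -/
lemma exists_nat_le_pow {β A : ℝ} (hβ0 : 0 < β) (hβ1 : β ≤ 1) (hA : 1 ≤ A) :
    ∃ S : ℕ, A ≤ (1 + β) ^ (S + 1) ∧ (S : ℝ) + 1 ≤ 2 / β * Real.log A + 2 := by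
  have hlog : 0 ≤ Real.log A := Real.log_nonneg hA
  refine ⟨⌈2 / β * Real.log A⌉₊, ?_, ?_⟩
  · have h1 : β / 2 ≤ Real.log (1 + β) := by
      refine le_trans ?_ (Real.one_sub_inv_le_log_of_pos (by linarith))
      have : 1 - (1 + β)⁻¹ = β / (1 + β) := by field_simp; ring
      rw [this]
      exact div_le_div_of_nonneg_left hβ0.le (by linarith) (by linarith)
    have h2 : 2 / β * Real.log A ≤ ((⌈2 / β * Real.log A⌉₊ + 1 : ℕ) : ℝ) := by
      push_cast
      linarith [Nat.le_ceil (2 / β * Real.log A)]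
    rw [← Real.log_le_log_iff (by linarith) (by positivity), Real.log_pow]
    calc Real.log A = 2 / β * Real.log A * (β / 2) := by field_simp
      _ ≤ _ := mul_le_mul h2 h1 (by linarith) (Nat.cast_nonneg _)
  · linarith [Nat.ceil_lt_add_one (show 0 ≤ 2 / β * Real.log A by positivity)]

/-- Since `ε ≤ M / 2`, the factor `log (M / ε)` is at least `log 2` and can absorb the constant `log
K`. -/
lemma log_mul_div_le {K M ε : ℝ} (hK : 1 ≤ K) (hε : 0 < ε) (hM : 0 < M) (hεM : ε ≤ M / 2) :
    Real.log (K * M / ε) ≤ (Real.log K / Real.log 2 + 1) * Real.log (M / ε) := by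
  have hlog2 : 0 < Real.log 2 := Real.log_pos one_lt_two
  have hMε : Real.log 2 ≤ Real.log (M / ε) := by
    refine Real.log_le_log two_pos ?_
    rw [le_div_iff₀ hε]
    linarith
  have h1 : Real.log (K * M / ε) = Real.log K + Real.log (M / ε) := by
    rw [mul_div_assoc, Real.log_mul (by positivity) (by positivity)]
  have h2 : Real.log K ≤ Real.log K / Real.log 2 * Real.log (M / ε) := by
    calc Real.log K = Real.log K / Real.log 2 * Real.log 2 := by field_simp
      _ ≤ _ := mul_le_mul_of_nonneg_left hMε (div_nonneg (Real.log_nonneg hK) hlog2.le)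
  linarith

lemma linear_initial_le {n σ L τ γ μ θ ρ Λ c M D Z : ℝ} (hn : 1 ≤ n) (hc : 0 < c) (hL : 0 < L)
    (hτ : 0 < τ) (hγ : 0 < γ) (hμ : 0 < μ) (hM : 0 < M) (hρ : 1 ≤ ρ) (hΛ : n ≤ Λ)
    (hσ : σ = γ * L * τ ^ 2) (hcσ : c ≤ 17 * σ) (hθ : L * τ ^ 2 * θ ^ 2 = n * μ)
    (hD : D ≤ M) (hZ : Z ≤ 2 * M / μ) :
    (Λ / 2 + 1 / ρ) * D + θ ^ 2 / (2 * γ) * Z ≤ Λ / 2 * ((3 + 34 / c) * M) := by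
  have hσ0 : 0 < σ := by rw [hσ]; positivity
  have h1 : θ ^ 2 / (2 * γ) * Z ≤ n * (17 / c) * M := by
    calc θ ^ 2 / (2 * γ) * Z ≤ θ ^ 2 / (2 * γ) * (2 * M / μ) := by gcongr
      _ = n * (1 / σ) * M := by
          have : θ ^ 2 = n * μ / (L * τ ^ 2) := by
            rw [eq_div_iff (by positivity)]; linarith
          rw [this, hσ]
          field_simp
      _ ≤ n * (17 / c) * M := by
          have : 1 / σ ≤ 17 / c := by
            rw [div_le_div_iff₀ hσ0 hc]
            linarith
          gcongr
  have h2 : 1 / ρ ≤ 1 := by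
    rw [div_le_one (by linarith)]
    exact hρ
  have h3 : (Λ / 2 + 1 / ρ) * D ≤ (Λ / 2 + Λ) * M := by
    have hρ0 : 0 ≤ 1 / ρ := by positivity
    calc (Λ / 2 + 1 / ρ) * D ≤ (Λ / 2 + 1 / ρ) * M :=
          mul_le_mul_of_nonneg_left hD (by linarith)
      _ ≤ _ := mul_le_mul_of_nonneg_right (by linarith) hM.le
  have h4 : n * (17 / c) * M ≤ Λ * (17 / c) * M := by gcongr
  calc _ ≤ (Λ / 2 + Λ) * M + Λ * (17 / c) * M := by linarith
    _ = Λ / 2 * ((3 + 34 / c) * M) := by ring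

lemma linear_calls_le {n θ c s Q ℓ K' : ℝ} (hn : 0 ≤ n) (hθ : 0 < θ) (hc : 0 < c) (hK' : 0 ≤ K')
    (hℓ : 0 ≤ ℓ) (hQ : Q ≤ K' * ℓ) (hs : s ≤ 2 / (c / 17 * θ) * Q + 2) :
    3 * n * s ≤ (6 + 102 / c * K') * (n + n / θ * ℓ) := by
  have h1 : 3 * n * s ≤ 3 * n * (2 / (c / 17 * θ) * Q + 2) :=
    mul_le_mul_of_nonneg_left hs (by positivity)
  have h2 : 3 * n * (2 / (c / 17 * θ) * Q + 2) = 102 / c * (n / θ) * Q + 6 * n := by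
    field_simp; ring
  have h3 : 102 / c * (n / θ) * Q ≤ 102 / c * (n / θ) * (K' * ℓ) := by gcongr
  have hA : 0 ≤ 102 / c * K' * n := by positivity
  have hB : 0 ≤ n / θ * ℓ := by positivity
  linarith

end Arithmetic

/-! ### Oracle complexity. -/

variable {V : Type*} [NormedAddCommGroup V] [InnerProductSpace ℝ V] [CompleteSpace V]
  [FiniteDimensional ℝ V] {n : ℕ} {τ : ℕ} {f : Fin n → V → ℝ} {h : V → ℝ} {γ : ℝ}

theorem exists_reachesWithin_sublinear.{u} {c L R ε : ℝ} {xstar : V} (hc : 0 < c) (hn : 0 < n)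
    (hL : 0 < L) (hγ : 0 < γ) (hε : 0 < ε) (hf : ∀ i, ConvexSmooth L (f i))
    (hh : ConvexOn ℝ Set.univ h) (hmin : ∀ x, objective f h xstar ≤ objective f h x)
    (hR : ‖xstar‖ ^ 2 ≤ R) (hF : objective f h 0 - objective f h xstar ≤ L * R)
    (hstep : 5 * γ * L + 10 * γ * L * τ ^ 2 ≤ 1) (hcstep : c ≤ 5 * γ * L + 10 * γ * L * τ ^ 2) :
    ∃ S : ℕ, ReachesWithin.{u} f h (uniformAverage n) (fun s => 2 / ((s : ℝ) + 4)) γ τ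
      (objective f h xstar) ε
      ((12 + 6 * √(20 / c)) * (n + (n + τ * √n) * √(L * R / ε))) S := by
  have hR0 : 0 ≤ R := (sq_nonneg _).trans hR
  have hn' : (1 : ℝ) ≤ n := by exact_mod_cast hn
  have hb0 : 0 ≤ √(20 / c) := Real.sqrt_nonneg _
  have hq0 : 0 ≤ √(L * R / ε) := Real.sqrt_nonneg _
  obtain ⟨K, hK⟩ : ∃ K, K = 4 + √(20 / c) * (1 + 2 * τ) / √n := ⟨_, rfl⟩
  have hK0 : 0 ≤ K := by rw [hK]; positivity
  obtain ⟨S, hS⟩ : ∃ S, S = ⌈√(L * R / ε) * K⌉₊ := ⟨_, rfl⟩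
  have hS1 : √(L * R / ε) * K ≤ S := hS ▸ Nat.le_ceil _
  have hS2 : (S : ℝ) < √(L * R / ε) * K + 1 := hS ▸ Nat.ceil_lt_add_one (mul_nonneg hq0 hK0)
  refine ⟨S, reachesWithin_of_rate ?_ fun Ω mΩ P hP ℱ I J hs => ?_⟩
  · have h1 := sublinear_calls_le hn' (Nat.cast_nonneg (α := ℝ) τ) hb0 hq0
    rw [← hK] at h1
    refine le_trans (mul_le_mul_of_nonneg_left ?_ (by positivity)) h1
    linarith
  · have hstep' : γ * L * (4 + 8 * τ ^ 2) ≤ 1 := by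
      have h1 : 0 ≤ γ * L := by positivity
      have h2 : 0 ≤ γ * L * τ ^ 2 := by positivity
      linarith
    refine sublinear_accuracy (by linarith) hc hL hγ hε hR0 (Real.sq_sqrt (by positivity)) hK0
      hcstep hF hR (hK ▸ sublinear_weight_le hn' (Nat.cast_nonneg τ) hb0) ?_ ?_
      (hs.sublinear_rate hn hL hγ hf hh hstep' hmin (S + 1))
    · push_cast
      linarith
    · positivity

theorem exists_reachesWithin_linear.{u} {c L μ M ε : ℝ} {xstar : V} (hc : 0 < c) (hn : 0 < n)
    (hL : 0 < L) (hμ : 0 < μ) (hγ : 0 < γ) (hε : 0 < ε) (hf : ∀ i, ConvexSmooth L (f i))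
    (hh : StrongConvexOn Set.univ μ h) (hmin : ∀ x, objective f h xstar ≤ objective f h x)
    (hM : objective f h 0 - objective f h xstar ≤ M) (hεM : ε ≤ M / 2)
    (hμL : μ ≤ L * τ ^ 2 / (4 * n)) (hstep : 5 * γ * L + 95 / 8 * τ ^ 2 * γ * L ≤ 1)
    (hcstep : c ≤ 5 * γ * L + 95 / 8 * τ ^ 2 * γ * L) :
    ∃ S : ℕ, ReachesWithin.{u} f h
      (geometricAverage (1 + μ * γ / (1 / τ * √(n * μ / L))) n)
      (fun _ => 1 / τ * √(n * μ / L)) γ τ (objective f h xstar) ε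
      ((6 + 102 / c * (Real.log (3 + 34 / c) / Real.log 2 + 1))
        * (n + τ * √(n * L / μ) * Real.log (M / ε))) S := by
  have hn' : (1 : ℝ) ≤ n := by exact_mod_cast hn
  have hn0 : (0 : ℝ) < n := by linarith
  -- For `τ = 0` the upper bound on `μ` would read `μ ≤ 0`.
  have hτ : 0 < τ := by
    rcases Nat.eq_zero_or_pos τ with h0 | h0
    · rw [h0] at hμL
      simp at hμL
      linarith
    · exact h0
  have hτ1 : (1 : ℝ) ≤ τ := by exact_mod_cast hτ
  have hτ0 : (0 : ℝ) < τ := by linarith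
  obtain ⟨θ, hθdef⟩ : ∃ θ, θ = 1 / τ * √(n * μ / L) := ⟨_, rfl⟩
  rw [← hθdef]
  have hθ0 : 0 < θ := by rw [hθdef]; positivity
  have hθ2 : L * τ ^ 2 * θ ^ 2 = n * μ := by
    rw [hθdef, mul_pow, Real.sq_sqrt (by positivity)]
    field_simp
  have hnθ : τ * √(n * L / μ) = n / θ := by
    rw [eq_div_iff hθ0.ne', hθdef]
    have h1 : √(n * L / μ) * √(n * μ / L) = n := by
      rw [← Real.sqrt_mul (by positivity)]
      have : n * L / μ * (n * μ / L) = (n : ℝ) ^ 2 := by field_simp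
      rw [this, Real.sqrt_sq hn0.le]
    calc _ = √(n * L / μ) * √(n * μ / L) := by field_simp
      _ = n := h1
  rw [hnθ]
  have hθ : θ ≤ 1 / 2 := by
    rw [le_div_iff₀ (by positivity)] at hμL
    have h1 : L * τ ^ 2 * θ ^ 2 ≤ L * τ ^ 2 * (1 / 2) ^ 2 := by linarith
    exact le_of_sq_le_sq (le_of_mul_le_mul_left h1 (by positivity)) (by norm_num)
  obtain ⟨σ, hσ⟩ : ∃ σ, σ = γ * L * τ ^ 2 := ⟨_, rfl⟩
  have hγL : 0 ≤ γ * L := by positivity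
  have hσ0 : 0 < σ := by rw [hσ]; positivity
  have hσ1 : σ ≤ 8 / 95 := by linarith
  -- As `τ ≥ 1`, the step quantity is at most `(5 + 95/8) σ`, and `5 + 95/8 < 17`. This fixes the
  -- contraction rate `β = c/17 · θ ≤ σθ`.
  have hcσ : c ≤ 17 * σ := by
    have h1 : γ * L * 1 ≤ γ * L * τ ^ 2 := mul_le_mul_of_nonneg_left (one_le_pow₀ hτ1) hγL
    linarith
  have hinc : μ * γ / θ = σ * θ / n := by
    rw [div_eq_div_iff hθ0.ne' hn0.ne', hσ]
    linear_combination -γ * hθ2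
  obtain ⟨ρ, hρ⟩ : ∃ ρ, ρ = 1 + μ * γ / θ := ⟨_, rfl⟩
  rw [← hρ]
  have hρ1 : 1 ≤ ρ := by rw [hρ]; linarith [show 0 ≤ μ * γ / θ by positivity]
  have hβσ : c / 17 * θ ≤ σ * θ := mul_le_mul_of_nonneg_right (by linarith) hθ0.le
  have hβ0 : 0 < c / 17 * θ := by positivity
  have hβ1 : c / 17 * θ ≤ 1 := by
    have : σ * θ ≤ 1 * θ := mul_le_mul_of_nonneg_right (by linarith) hθ0.le
    linarith
  obtain ⟨hκ, hgrowth, hcontr⟩ := weight_growth hn hσ0 hσ1 hθ0 hθ (hinc ▸ hρ) hβσ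
  have hM0 : 0 < M := by linarith
  have hK1 : 1 ≤ 3 + 34 / c := by linarith [show 0 < 34 / c by positivity]
  have hKM : 1 ≤ (3 + 34 / c) * M / ε := by
    rw [le_div_iff₀ hε]
    linarith [mul_le_mul_of_nonneg_right hK1 hM0.le]
  obtain ⟨S, hSpow, hSle⟩ := exists_nat_le_pow hβ0 hβ1 hKM
  refine ⟨S, reachesWithin_of_rate ?_ fun Ω mΩ P hP ℱ I J hs => ?_⟩
  · refine linear_calls_le hn0.le hθ0 hc ?_ ?_ (log_mul_div_le hK1 hε hM0 hεM) hSle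
    · exact add_nonneg (div_nonneg (Real.log_nonneg hK1) (Real.log_nonneg one_le_two)) zero_le_one
    · refine Real.log_nonneg ?_
      rw [le_div_iff₀ hε]
      linarith
  · have hstep' : γ * L * (4 + 8 * (95 / 64) * τ ^ 2) ≤ 1 := by linarith
    have hrate := hs.linear_rate hn hL hμ.le hγ hθ0 hθ hf hh hρ (fun m _ hm => hκ m hm) hstep'
      hgrowth hcontr hβ0.le hmin (S + 1)
    -- Quadratic growth of the objective at its minimiser, tested at the starting point `0`.
    have hdist : ‖xstar‖ ^ 2 ≤ 2 * M / μ := by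
      have := strongConvexOn_add_norm_sq_le_of_isMin
        (strongConvexOn_objective (fun i => (hf i).1) hh) hmin 0
      rw [zero_sub, norm_neg] at this
      rw [le_div_iff₀ hμ]
      linarith
    have hΛ : (n : ℝ) ≤ ∑ k ∈ Finset.range n, ρ ^ k := by
      have := Finset.sum_le_sum fun k (_ : k ∈ Finset.range n) => one_le_pow₀ (n := k) hρ1
      simpa using this
    have hbound := hrate.trans
      (linear_initial_le hn' hc hL hτ0 hγ hμ hM0 hρ1 hΛ hσ hcσ hθ2 hM hdist)
    rw [mul_left_comm] at hbound
    have h2 := le_of_mul_le_mul_left hbound (by linarith)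
    rw [div_le_iff₀ hε] at hSpow
    exact le_of_mul_le_mul_left (h2.trans hSpow) (by positivity)

end

end AASVRG

end

open AASVRG in
theorem corollary3 :
    -- not strongly convex
    (∀ c : ℝ, 0 < c → ∃ C : ℝ, ∀ (d n τ : ℕ) (L γ R ε : ℝ)
      (f : Fin n → EuclideanSpace ℝ (Fin d) → ℝ) (h : EuclideanSpace ℝ (Fin d) → ℝ)
      (xstar : EuclideanSpace ℝ (Fin d)),
      0 < n → 0 < L → 0 < γ → 0 < ε →
      (∀ i, ConvexSmooth L (f i)) → ConvexOn ℝ Set.univ h →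
      (∀ x, objective f h xstar ≤ objective f h x) →
      ‖xstar‖ ^ 2 ≤ R → objective f h 0 - objective f h xstar ≤ L * R →
      5 * γ * L + 10 * γ * L * τ ^ 2 ≤ 1 → c ≤ 5 * γ * L + 10 * γ * L * τ ^ 2 →
      ∃ S : ℕ, ReachesWithin f h (uniformAverage n) (fun s => 2 / ((s : ℝ) + 4)) γ τ
        (objective f h xstar) ε
        (C * (n + (n + τ * √n) * √(L * R / ε))) S) ∧
    -- strongly convex
    (∀ c : ℝ, 0 < c → ∃ C : ℝ, ∀ (d n τ : ℕ) (L μ γ M ε : ℝ)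
      (f : Fin n → EuclideanSpace ℝ (Fin d) → ℝ) (h : EuclideanSpace ℝ (Fin d) → ℝ)
      (xstar : EuclideanSpace ℝ (Fin d)),
      0 < n → 0 < L → 0 < μ → 0 < γ → 0 < ε →
      (∀ i, ConvexSmooth L (f i)) → StrongConvexOn Set.univ μ h →
      (∀ x, objective f h xstar ≤ objective f h x) →
      objective f h 0 - objective f h xstar ≤ M → ε ≤ M / 2 →
      μ ≤ L * τ ^ 2 / (4 * n) →
      5 * γ * L + 95 / 8 * τ ^ 2 * γ * L ≤ 1 → c ≤ 5 * γ * L + 95 / 8 * τ ^ 2 * γ * L →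
      ∃ S : ℕ, ReachesWithin f h
        (geometricAverage (1 + μ * γ / (1 / τ * √(n * μ / L))) n)
        (fun _ => 1 / τ * √(n * μ / L)) γ τ
        (objective f h xstar) ε
        (C * (n + τ * √(n * L / μ) * Real.log (M / ε))) S) := by
  refine ⟨fun c hc => ⟨12 + 6 * √(20 / c), ?_⟩,
    fun c hc => ⟨6 + 102 / c * (Real.log (3 + 34 / c) / Real.log 2 + 1), ?_⟩⟩
  · intro d n τ L γ R ε f h xstar hn hL hγ hε hf hh hmin hR hF hstep hcstep
    exact exists_reachesWithin_sublinear hc hn hL hγ hε hf hh hmin hR hF hstep hcstep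
  · intro d n τ L μ γ M ε f h xstar hn hL hμ hγ hε hf hh hmin hM hεM hμL hstep hcstep
    exact exists_reachesWithin_linear hc hn hL hμ hγ hε hf hh hmin hM hεM hμL hstep hcstep
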